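/- Let $G$ be a finite group, $p$ a prime, $R$ the ring of all algebraic integers in $\mathbb{C}$, $K$ its field of fractions, $I$ a maximal ideal of $R$ containing $p$, and $F=R/I$. Let $\mathrm{Irr}(G)$ be the set of irreducible $K$-characters and $\mathrm{IBr}(G)$ the set of irreducible Brauer characters of $G$ with respect to $(K,R,F)$; Brauer characters are extended by $0$ to the $p$-singular elements. For a class function $\chi$ let $\hat\chi$ be the function that agrees with $\chi$ on $p$-regular elements and is $0$ on $p$-singular elements, and let $\langle\lambda,\mu\rangle=|G|^{-1}\sum_{g\in G}\lambda(g)\overline{\mu(g)}$. Define the decomposition numbers $d_{\chi\varphi}$ by $\hat\chi=\sum_{\varphi\in \mathrm{IBr}(G)} d_{\chi\varphi}\varphi$ and the PIMs by $\Phi_\varphi=\sum_{\chi\in\mathrm{Irr}(G)}d_{\chi\varphi}\chi$. A (generalized) projective character is a linear combination of PIMs with non-negative integral (respectively, integral) coefficients. Let $B$ be a union of $p$-blocks of $G$ and let $\mathrm{Irr}(B)$, $\mathrm{IBr}(B)$ be the sets of irreducible ordinary and Brauer characters in $B$. Let $G_0(\hat B)$ be the $\mathbb{Z}$-span of $\mathrm{IBr}(B)$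 and $K_0(B)$ the $\mathbb{Z}$-span of the PIMs $\Phi_\varphi$, $\varphi\in \mathrm{IBr}(B)$. Let $\mathbf{BS}=\{\varphi_1,\dots,\varphi_s\}$ be a special basic set of $B$, i.e. a $\mathbb{Z}$-basis of $G_0(\hat B)$ consisting of Brauer characters each of which is of the form $\hat\chi$ with $\chi\in\mathrm{Irr}(B)$, and let $\{\varphi_1^*,\dots,\varphi_s^*\}$ be the basis of $K_0(B)$ dual to $\mathbf{BS}$ with respect to $\langle\ ,\ \rangle$. Let $\mathbf{B}=\{\hat\chi : \chi\in\mathrm{Irr}(B)\}$, and let $\Phi=\sum_i n_i\varphi_i^*=\sum_{\chi\in\mathrm{Irr}(B)}a_\chi\chi$ be a projective character in $B$. A part of $\Phi$ is a generalized projective character $\Phi'=\sum_i n_i'\varphi_i^*$ with integers $0\le n_i'\le n_i$ for all $i$. The PIM-test is said to prove $\Phi$ indecomposable if for every part $\Phi'$ of $\Phi$ with $\Phi'\ne\Phi$ and $\Phi'\neq 0$ there is $\varphi\in\mathbf{B}$ with $\langle\varphi,\Phi'\rangle<0$ or $\langle\varphi,\Phi-\Phi'\rangle<0$. A subsum of $\Phi$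 is a character $\Phi'=\sum_{\chi\in\mathrm{Irr}(B)}a'_\chi\chi$ with integers $0\le a'_\chi\le a_\chi$ for all $\chi$, $\Phi'\ne0$ and $\Phi'\neq\Phi$. Then the PIM-test proves $\Phi$ indecomposable if and only if no subsum of $\Phi$ is a generalized projective character. -/

import Mathlib

noncomputable section

namespace ModRep

/-- The ring `R` of all algebraic integers (in `ℂ`). -/
abbrev AlgInt : Subalgebra ℤ ℂ := integralClosure ℤ ℂ

/-- The field `K` of all algebraic numbers (in `ℂ`), the quotient field of `R`. -/
abbrev AlgNum : IntermediateField ℚ ℂ := algebraicClosure ℚ ℂ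

/-- The set `Irr(G)` of ordinary irreducible `K`-characters of `G`. -/
def Irr (G : Type*) [Group G] : Set (G → ℂ) :=
  {χ | ∃ (n : ℕ) (ρ : Representation AlgNum G (Fin n → AlgNum)),
    ρ.IsIrreducible ∧ χ = fun g => ((ρ.character g : AlgNum) : ℂ)}

/-- The restriction `χ̂` of a class function to the `p`-regular elements, extended by zero. -/
def hat {G : Type*} [Group G] (p : ℕ) (χ : G → ℂ) : G → ℂ :=
  fun g => if p ∣ orderOf g then 0 else χ g

/-- The usual inner product `⟨lam, mu⟩ = |G|⁻¹ ∑ lam(g) conj (mu(g))` of functions on `G`. -/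
def ip {G : Type*} [Fintype G] (lam mu : G → ℂ) : ℂ :=
  (Fintype.card G : ℂ)⁻¹ * ∑ g, lam g * (starRingEnd ℂ) (mu g)

/-- The residue class field `F = R/I`. -/
def ResField (I : Ideal AlgInt) : Type := AlgInt ⧸ I

instance instFieldResField (I : Ideal AlgInt) [I.IsMaximal] : Field (ResField I) := Ideal.Quotient.field I

/-- The canonical epimorphism `R → F`. -/
def red (I : Ideal AlgInt) [I.IsMaximal] : AlgInt →+* ResField I := Ideal.Quotient.mk I

/-- The inverse of the bijection, induced by `R → F`, from the `|G|_{p'}`-th roots of unity in `R`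
to the `|G|_{p'}`-th roots of unity in `F`. Here `|G|_{p'}` is the largest divisor of `|G|` that is
prime to `p`. -/
def rootLift (G : Type*) [Group G] (p : ℕ) (I : Ideal AlgInt) [I.IsMaximal] (z : ResField I) :
    AlgInt :=
  Classical.epsilon fun u : AlgInt =>
    u ^ (Nat.card G / p ^ (Nat.card G).factorization p) = 1 ∧ red I u = z

section

variable {G : Type*} [Group G] (p : ℕ) (I : Ideal AlgInt) [I.IsMaximal]

/-- The Brauer character afforded by a representation over `F = R/I`: its value at a `p`-regular
`g` is the sum of the lifts of the eigenvalues of `g` (with multiplicity); it is extended by zero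
to the `p`-singular elements. -/
def brauerCharacter {n : ℕ} (ρ : Representation (ResField I) G (Fin n → ResField I)) : G → ℂ :=
  fun g => if p ∣ orderOf g then 0
    else ((ρ g).charpoly.roots.map fun z => (rootLift G p I z : ℂ)).sum

variable (G) in
/-- The set of all Brauer characters of `G`. -/
def BrauerCharacters : Set (G → ℂ) :=
  {θ | ∃ (n : ℕ) (ρ : Representation (ResField I) G (Fin n → ResField I)),
    θ = brauerCharacter p I ρ}

variable (G) in
/-- The set `IBr(G)` of irreducible Brauer characters of `G`. -/
def IBr : Set (G → ℂ) :=
  {θ | ∃ (n : ℕ) (ρ : Representation (ResField I) G (Fin n → ResField I)),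
    ρ.IsIrreducible ∧ θ = brauerCharacter p I ρ}

/-- The decomposition numbers `d_{χφ}`: the non-negative integers with
`χ̂ = ∑_{φ ∈ IBr(G)} d_{χφ} φ`. -/
def decompositionNumber (χ : G → ℂ) : IBr G p I →₀ ℕ :=
  Classical.epsilon fun d : IBr G p I →₀ ℕ => hat p χ = d.sum fun φ k => k • (φ : G → ℂ)

/-- The projective indecomposable character `Φ_φ = ∑_{χ ∈ Irr(G)} d_{χφ} χ`. -/
def PIM (φ : IBr G p I) : G → ℂ :=
  ∑ᶠ χ : Irr G, decompositionNumber p I (χ : G → ℂ) φ • (χ : G → ℂ)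

variable (G) in
/-- The Brauer graph on `Irr(G)`; distinct `χ`, `ψ` are linked if they have a common irreducible
Brauer constituent. -/
def brauerGraph : SimpleGraph (Irr G) :=
  SimpleGraph.fromRel fun χ ψ => ∃ φ : IBr G p I,
    decompositionNumber p I (χ : G → ℂ) φ ≠ 0 ∧ decompositionNumber p I (ψ : G → ℂ) φ ≠ 0

variable (G) in
/-- The blocks of `G`: the connected components of the Brauer graph. -/
abbrev Block : Type _ := (brauerGraph G p I).ConnectedComponent

variable (G) in
/-- The group `K₀(FG)` of generalized projective characters of `G`. -/
def GenProj : Submodule ℤ (G → ℂ) := Submodule.span ℤ (Set.range (PIM (G := G) p I))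

variable {p I}

/-- `Irr(B)`, for a union of blocks `B` (given as a set of blocks). -/
def IrrB (B : Set (Block G p I)) : Set (G → ℂ) :=
  {χ | ∃ h : χ ∈ Irr G, (brauerGraph G p I).connectedComponentMk ⟨χ, h⟩ ∈ B}

/-- `IBr(B)`: the irreducible Brauer characters occurring in some `χ̂` with `χ ∈ Irr(B)`. -/
def IBrB (B : Set (Block G p I)) : Set (IBr G p I) :=
  {φ | ∃ χ ∈ IrrB B, decompositionNumber p I χ φ ≠ 0}

/-- `G₀(B̂)`: the generalized Brauer characters in `B`. -/
def GenBrauerB (B : Set (Block G p I)) : Submodule ℤ (G → ℂ) :=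
  Submodule.span ℤ (Subtype.val '' IBrB B)

/-- `K₀(B)`: the generalized projective characters in `B`. -/
def GenProjB (B : Set (Block G p I)) : Submodule ℤ (G → ℂ) :=
  Submodule.span ℤ (PIM p I '' IBrB B)

/-- The (genuine) projective characters in `B`: the combinations of PIMs of `B` with
non-negative integral coefficients. -/
def ProjB (B : Set (Block G p I)) : AddSubmonoid (G → ℂ) :=
  AddSubmonoid.closure (PIM p I '' IBrB B)

/-- A basic set of Brauer characters of `B`: a `ℤ`-basis of `G₀(B̂)` consisting of Brauer
characters. -/
structure IsBasicSet (B : Set (Block G p I)) {s : ℕ} (BS : Fin s → G → ℂ) : Prop where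
  brauer : ∀ i, BS i ∈ BrauerCharacters G p I
  linearIndependent : LinearIndependent ℤ BS
  span_eq : Submodule.span ℤ (Set.range BS) = GenBrauerB B

/-- A special basic set: all members are restrictions of characters in `Irr(B)` to the
`p`-regular classes. -/
structure IsSpecialBasicSet (B : Set (Block G p I)) {s : ℕ} (BS : Fin s → G → ℂ) : Prop
    extends IsBasicSet B BS where
  special : ∀ i, ∃ χ ∈ IrrB B, BS i = hat p χ

/-- The set of all restrictions `χ̂` of the ordinary characters `χ ∈ Irr(B)`. -/
def hatIrrB (B : Set (Block G p I)) : Set (G → ℂ) := hat p '' IrrB B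

end

section

variable {G : Type*} [Group G] [Fintype G] {p : ℕ} {I : Ideal AlgInt} [I.IsMaximal]

/-- `PA` is the basis of `K₀(B)` dual to `BS` with respect to the inner product. -/
structure IsDualBasis (B : Set (Block G p I)) {s : ℕ} (BS PA : Fin s → G → ℂ) : Prop where
  linearIndependent : LinearIndependent ℤ PA
  span_eq : Submodule.span ℤ (Set.range PA) = GenProjB B
  dual : ∀ i j, ip (BS i) (PA j) = if i = j then 1 else 0

/-- The basis `PA` of projective atoms dual to the basic set `BS`. -/
def atoms (B : Set (Block G p I)) {s : ℕ} (BS : Fin s → G → ℂ) : Fin s → G → ℂ :=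
  Classical.epsilon (IsDualBasis B BS)

/-- `Φ'` is a part of `Φ`: it is a generalized projective character, and if
`Φ = ∑ nᵢ φᵢ*` and `Φ' = ∑ nᵢ' φᵢ*` are the expansions into the atoms dual to `BS`, then
`0 ≤ nᵢ' ≤ nᵢ` for all `i`. -/
def IsPart (B : Set (Block G p I)) {s : ℕ} (BS : Fin s → G → ℂ) (Φ Φ' : G → ℂ) : Prop :=
  Φ' ∈ GenProj G p I ∧ ∃ n n' : Fin s → ℤ,
    Φ = ∑ i, n i • atoms B BS i ∧ Φ' = ∑ i, n' i • atoms B BS i ∧ ∀ i, 0 ≤ n' i ∧ n' i ≤ n i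

/-- The PIM-test with basic set `BS` and set `BB` of Brauer characters proves that `Φ` is
indecomposable: every part of `Φ` other than `0` and `Φ` is excluded by some `φ` in `BB`.
(The inner products in question are integers.) -/
def PIMTestProves (B : Set (Block G p I)) {s : ℕ} (BS : Fin s → G → ℂ) (BB : Set (G → ℂ))
    (Φ : G → ℂ) : Prop :=
  ∀ Φ', IsPart B BS Φ Φ' → Φ' ≠ Φ → Φ' ≠ 0 →
    ∃ φ ∈ BB, (ip φ Φ').re < 0 ∨ (ip φ (Φ - Φ')).re < 0

/-- `Φ'` is a (proper, nonzero) subsum of `Φ = ∑ a_χ χ`, the sum being over `Irr(B)`: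
`Φ' = ∑ a'_χ χ` with `0 ≤ a'_χ ≤ a_χ`, `Φ' ≠ 0` and `Φ' ≠ Φ`. -/
def IsSubsum (B : Set (Block G p I)) (Φ Φ' : G → ℂ) : Prop :=
  (∃ a a' : IrrB B →₀ ℕ, a' ≤ a ∧ (Φ = a.sum fun χ k => k • (χ : G → ℂ)) ∧
    (Φ' = a'.sum fun χ k => k • (χ : G → ℂ))) ∧ Φ' ≠ 0 ∧ Φ' ≠ Φ

end

end ModRep

end

noncomputable section

namespace ModRep

open Module Polynomial

open scoped MonoidAlgebra

/-! A generalized projective character `X` vanishes on `p`-singular elements, so `⟨χ̂, X⟩ = ⟨χ, X⟩`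
is the multiplicity of `χ` in `X` (`ip_hat_of_mem_GenProj`). Hence a part `Φ'` survives the test
with all `χ̂`, `χ ∈ Irr(B)`, exactly when both `Φ'` and `Φ - Φ'` have non-negative multiplicities,
that is, when `0 ≤ a'_χ ≤ a_χ`. Conversely, a subsum in `K₀(G)` is a part: the basic set is special,
so its coordinates `n'_i = ⟨φ_i, Φ'⟩` are some of the multiplicities `a'_χ`.

The bulk of the work is the modular theory behind this. Decomposition numbers and atoms are chosen
by `epsilon`, so their existence must be proved: `exists_brauerCharacter_eq_hat` reduces a
representation modulo `I`, `brauerFun_mem_closure_IBr` splits it into irreducibles, and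
`exists_isDualBasis` produces the atoms. Linear independence of `IBr(G)` (`linearIndependent_IBr`)
yields the duality between `IBr(G)` and the PIMs and the vanishing of PIMs on `p`-singular elements.
Finally, `mem_GenProjB` places a subsum lying in `K₀(G)` inside `K₀(B)`. -/

/-! ### Linear algebra: characteristic polynomials, traces, eigenvalues. -/

theorem charpoly_eq_mul_charpoly_quotient {k V : Type*} [Field k] [AddCommGroup V] [Module k V]
    [Module.Finite k V] (W : Submodule k V) (e : V →ₗ[k] V) (he : W ≤ W.comap e) :
    e.charpoly = (e.restrict he).charpoly * (W.mapQ W e he).charpoly := by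
  classical
  let m := Module.Free.ChooseBasisIndex k W
  let bW : Basis m k W := Module.Free.chooseBasis k W
  let n := Module.Free.ChooseBasisIndex k (V ⧸ W)
  let bQ : Basis n k (V ⧸ W) := Module.Free.chooseBasis k (V ⧸ W)
  let b := Basis.sumQuot bW bQ
  let A : Matrix m m k := LinearMap.toMatrix bW bW (e.restrict he)
  let B : Matrix m n k := Matrix.of fun i l ↦
    ((Basis.sumQuot bW bQ).repr (e ((Basis.sumQuot bW bQ) (Sum.inr l)))) (Sum.inl i)
  let D : Matrix n n k := LinearMap.toMatrix bQ bQ (W.mapQ W e he)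
  suffices LinearMap.toMatrix b b e = Matrix.fromBlocks A B 0 D by
    rw [← LinearMap.charpoly_toMatrix e b, this, ← LinearMap.charpoly_toMatrix _ bW,
      ← LinearMap.charpoly_toMatrix _ bQ, Matrix.charpoly_fromBlocks_zero₂₁]
  ext u v
  cases u with
  | inl i =>
    cases v with
    | inl l =>
      simp only [b, Basis.sumQuot_inl, Matrix.fromBlocks_apply₁₁, A, LinearMap.toMatrix_apply]
      apply Basis.sumQuot_repr_inl_of_mem
    | inr l => simp [b, LinearMap.toMatrix_apply, Matrix.fromBlocks_apply₁₂, B]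
  | inr j =>
    cases v with
    | inl l =>
      suffices W.mkQ (e (bW l)) = 0 by simp [LinearMap.toMatrix_apply, b, this]
      rw [← LinearMap.mem_ker, Submodule.ker_mkQ]
      exact he (Submodule.coe_mem (bW l))
    | inr l =>
      simp only [LinearMap.toMatrix_apply, Basis.sumQuot_repr_inr,
        Matrix.fromBlocks_apply₂₂, b, D]
      rw [← Basis.sumQuot_inr bW bQ]
      rfl

/-- By the Frobenius identity `f - g` is nilpotent, so its trace is zero. This lets a trace in
characteristic `p` ignore the `p`-part of a group element. -/
theorem trace_eq_of_commute_of_pow_char_pow_eq {k V : Type*} [Field k] [AddCommGroup V]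
    [Module k V] (p n : ℕ) [Fact p.Prime] [CharP k p] {f g : Module.End k V}
    (hc : Commute f g) (h : f ^ p ^ n = g ^ p ^ n) :
    LinearMap.trace k V f = LinearMap.trace k V g := by
  cases subsingleton_or_nontrivial V with
  | inl hV => rw [Subsingleton.elim f g]
  | inr hV =>
  have : CharP (Module.End k V) p := charP_of_injective_algebraMap
    (FaithfulSMul.algebraMap_injective k (Module.End k V)) p
  have h0 : (f - g) ^ p ^ n = 0 := by rw [sub_pow_char_pow_of_commute _ _ hc, h, sub_self]
  have := (LinearMap.isNilpotent_trace_of_isNilpotent (R := k) (M := V) ⟨_, h0⟩).eq_zero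
  rwa [map_sub, sub_eq_zero] at this

/-- Eigenvalues of an endomorphism of finite order, and the traces of its powers. -/
theorem exists_trace_pow_eq_sum {V : Type*} {k : Type*} [Field k] [IsAlgClosed k] [CharZero k]
    [AddCommGroup V] [Module k V] [FiniteDimensional k V] (f : Module.End k V) {N : ℕ}
    (hN : N ≠ 0) (hf : f ^ N = 1) :
    ∃ s : Multiset k, (∀ u ∈ s, u ^ N = 1) ∧
      ∀ j : ℕ, LinearMap.trace k V (f ^ j) = (s.map (· ^ j)).sum := by
  classical
  have hsep : (X ^ N - 1 : k[X]).Separable := by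
    have := separable_X_pow_sub_C (1 : k) (n := N) (by exact_mod_cast hN) one_ne_zero
    simpa using this
  have hss : f.IsSemisimple := by
    refine Module.End.isSemisimple_of_squarefree_aeval_eq_zero hsep.squarefree ?_
    simp [hf]
  have hint : DirectSum.IsInternal f.eigenspace := by
    apply DirectSum.isInternal_submodule_of_iSupIndep_of_iSup_eq_top
    · exact f.eigenspaces_iSupIndep
    · exact hss.iSup_eigenspace_eq_top
  have hfin : {i | f.eigenspace i ≠ ⊥}.Finite :=
    WellFoundedGT.finite_ne_bot_of_iSupIndep f.eigenspaces_iSupIndep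
  refine ⟨∑ u ∈ hfin.toFinset, Multiset.replicate (finrank k (f.eigenspace u)) u, ?_, ?_⟩
  · intro u hu
    obtain ⟨v, hv, hu⟩ := Multiset.mem_sum.1 hu
    obtain rfl := Multiset.eq_of_mem_replicate hu
    obtain ⟨x, hx⟩ := (Submodule.ne_bot_iff _).1 ((Set.Finite.mem_toFinset _).1 hv)
    have hx' : (f ^ N) x = u ^ N • x := by
      have : f.HasEigenvector u x := hx
      exact this.pow_apply N
    rw [hf] at hx'
    have : (u ^ N - 1) • x = 0 := by rw [sub_smul, ← hx']; simp
    exact sub_eq_zero.1 ((smul_eq_zero.1 this).resolve_right hx.2)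
  · intro j
    have hmaps : ∀ u, Set.MapsTo (f ^ j) (f.eigenspace u) (f.eigenspace u) := fun u =>
      Module.End.mapsTo_genEigenspace_of_comm (Commute.pow_right (Commute.refl f) j) u 1
    rw [LinearMap.trace_eq_sum_trace_restrict' hint hfin hmaps]
    rw [show ((∑ u ∈ hfin.toFinset, Multiset.replicate (finrank k (f.eigenspace u)) u).map
      (· ^ j)).sum = ∑ u ∈ hfin.toFinset, finrank k (f.eigenspace u) • u ^ j by
        rw [← Multiset.coe_mapAddMonoidHom, map_sum, ← Multiset.coe_sumAddMonoidHom, map_sum]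
        simp]
    refine Finset.sum_congr rfl fun u _ => ?_
    have : (f ^ j).restrict (hmaps u) = (u ^ j) • (1 : Module.End k (f.eigenspace u)) := by
      refine LinearMap.ext fun x => ?_
      have hx : f x = u • (x : V) := Module.End.mem_eigenspace_iff.1 x.2
      have : ∀ j : ℕ, (f ^ j) x = u ^ j • (x : V) := by
        intro j
        induction j with
        | zero => simp
        | succ j ih => rw [pow_succ', Module.End.mul_apply, ih, map_smul, hx, smul_smul, pow_succ]
      exact Subtype.ext (this j)
    rw [this, map_smul, LinearMap.trace_one]
    simp [mul_comm]

/-! ### Equivalence of representations and transport to coordinates. -/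

section

variable {k G V W : Type*} [Group G] [Field k] [AddCommGroup V] [Module k V] [AddCommGroup W]
  [Module k W]

theorem isIrreducible_of_equiv {ρ : Representation k G V} {σ : Representation k G W}
    (φ : ρ.Equiv σ) (h : ρ.IsIrreducible) : σ.IsIrreducible := by
  rw [Representation.irreducible_iff_isSimpleModule_asModule] at h ⊢
  have e : σ.asModule ≃ₗ[k[G]] ρ.asModule := LinearEquiv.ofBijective
    (Representation.IntertwiningMap.equivLinearMapAsModule σ ρ φ.symm.toIntertwiningMap)
    φ.symm.toLinearEquiv.bijective
  exact IsSimpleModule.congr e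

/-- Transport of a representation along a linear equivalence. -/
def transport (ρ : Representation k G V) (e : V ≃ₗ[k] W) : Representation k G W :=
  (e.conjAlgEquiv k : End k V →* End k W).comp ρ

theorem transport_apply (ρ : Representation k G V) (e : V ≃ₗ[k] W) (g : G) :
    transport ρ e g = e.conj (ρ g) := rfl

/-- A representation is equivalent to each of its transports. -/
def transportEquiv (ρ : Representation k G V) (e : V ≃ₗ[k] W) : ρ.Equiv (transport ρ e) :=
  Representation.Equiv.mk e fun g => by
    ext v
    simp [transport_apply, LinearEquiv.conj_apply]

theorem exists_equiv_fin [FiniteDimensional k V] (ρ : Representation k G V) :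
    ∃ (n : ℕ) (σ : Representation k G (Fin n → k)), Nonempty (ρ.Equiv σ) :=
  ⟨finrank k V, transport ρ (finBasis k V).equivFun, ⟨transportEquiv ρ _⟩⟩

end

/-! ### Separating simple modules by the density theorem. -/

section density

variable {F A ι : Type*} [Field F] [Ring A] [Algebra F A] [Fintype ι] [DecidableEq ι]

theorem exists_trace_eq_one (F V : Type*) [Field F] [AddCommGroup V] [Module F V]
    [FiniteDimensional F V] [Nontrivial V] : ∃ E : End F V, LinearMap.trace F V E = 1 := by
  obtain ⟨v, hv⟩ := exists_ne (0 : V)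
  obtain ⟨f, hf⟩ := Projective.exists_dual_eq_one F hv
  exact ⟨dualTensorHom F V V (TensorProduct.tmul F f v), by
    rw [LinearMap.trace_eq_contract_apply, contractLeft_apply, hf]⟩

/-- By Schur's lemma an `A`-endomorphism of `∏ M i` acts by a scalar on each factor. So `E` on the
factor `i₀`, and zero elsewhere, commutes with all of them, and Jacobson density realizes it by an
element of `A`. -/
theorem exists_smul_eq_of_pairwise_not_linearEquiv [IsAlgClosed F] {M : ι → Type*}
    [∀ i, AddCommGroup (M i)] [∀ i, Module F (M i)] [∀ i, Module A (M i)]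
    [∀ i, IsScalarTower F A (M i)] [∀ i, FiniteDimensional F (M i)] [∀ i, IsSimpleModule A (M i)]
    (hne : ∀ i j, i ≠ j → IsEmpty (M i ≃ₗ[A] M j)) (i₀ : ι) (E : End F (M i₀)) :
    ∃ x : A, (∀ v : M i₀, x • v = E v) ∧ ∀ i, i ≠ i₀ → ∀ v : M i, x • v = 0 := by
  classical
  have key : ∀ (φ : End A (∀ i, M i)) (i₀ : ι), ∃ c : F, ∀ m, φ m i₀ = c • m i₀ := by
    intro φ i₀
    let ψ : ∀ j, M j →ₗ[A] M i₀ := fun j => LinearMap.proj i₀ ∘ₗ φ ∘ₗ LinearMap.single A M j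
    have h0 : ∀ j, j ≠ i₀ → ψ j = 0 := fun j hj =>
      (LinearMap.bijective_or_eq_zero (ψ j)).resolve_left fun hb =>
        (hne j i₀ hj).false (LinearEquiv.ofBijective _ hb)
    obtain ⟨c, hc⟩ := (IsSimpleModule.algebraMap_end_bijective_of_isAlgClosed (A := A)
      (V := M i₀) F).2 (ψ i₀)
    refine ⟨c, fun m => ?_⟩
    have hm : φ m i₀ = ∑ j, ψ j (m j) := by
      conv_lhs => rw [← Finset.univ_sum_single m, map_sum, Finset.sum_apply]
      rfl
    rw [hm, Finset.sum_eq_single i₀ (fun j _ hj => by rw [h0 j hj]; rfl) (by simp), ← hc]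
    rfl
  let f : End (End A (∀ i, M i)) (∀ i, M i) :=
    { toFun := fun m => Pi.single i₀ (E (m i₀))
      map_add' := fun m m' => by rw [Pi.add_apply, map_add, Pi.single_add]
      map_smul' := fun φ m => by
        obtain ⟨c, hc⟩ := key φ i₀
        have hφ : φ (Pi.single i₀ (E (m i₀))) = Pi.single i₀ (c • E (m i₀)) := by
          funext i
          obtain ⟨d, hd⟩ := key φ i
          rw [hd]
          by_cases hi : i = i₀
          · subst hi
            rw [← hd, hc, Pi.single_eq_same, Pi.single_eq_same]
          · rw [Pi.single_eq_of_ne hi, Pi.single_eq_of_ne hi, smul_zero]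
        change Pi.single i₀ (E (φ m i₀)) = φ (Pi.single i₀ (E (m i₀)))
        rw [hφ, hc, map_smul] }
  -- Density only matches finitely many vectors; an `F`-basis of the product suffices, since both
  -- sides are `F`-linear.
  let s : Finset (∀ i, M i) := Finset.univ.biUnion fun i =>
    Finset.univ.image fun j => Pi.single i (finBasis F (M i) j)
  obtain ⟨x, hx⟩ := jacobson_density f s
  have hx' : ∀ i j, Pi.single i₀ (E ((Pi.single i (finBasis F (M i) j) : ∀ i, M i) i₀))
      = x • (Pi.single i (finBasis F (M i) j) : ∀ i, M i) := fun i j =>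
    hx _ (by
      simp only [s, Finset.mem_biUnion, Finset.mem_image]
      exact ⟨i, by simp, j, by simp, rfl⟩)
  have hl : ∀ i, ∃ l : End F (M i), ∀ v, l v = x • v := fun i =>
    ⟨Algebra.lsmul F F (M i) x, fun v => rfl⟩
  refine ⟨x, ?_, fun i hi => ?_⟩
  · obtain ⟨l, hl⟩ := hl i₀
    suffices l = E by intro v; rw [← hl, this]
    refine (finBasis F (M i₀)).ext fun j => ?_
    have := congrFun (hx' i₀ j) i₀
    rw [Pi.smul_apply, Pi.single_eq_same, Pi.single_eq_same] at this
    rw [hl, this]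
  · obtain ⟨l, hl⟩ := hl i
    suffices l = 0 by intro v; rw [← hl, this]; rfl
    refine (finBasis F (M i)).ext fun j => ?_
    have := congrFun (hx' i j) i
    rw [Pi.single_eq_of_ne hi, Pi.smul_apply, Pi.single_eq_same] at this
    rw [hl, ← this]; rfl

end density

/-! ### Group algebras: separation and completeness of irreducible characters. -/

section

variable {k G V : Type*} [Group G] [Fintype G] [Field k] [AddCommGroup V] [Module k V]

theorem asAlgebraHom_sum_single (ρ : Representation k G V) (f : G → k) :
    ρ.asAlgebraHom (∑ g, MonoidAlgebra.single g (f g)) = ∑ g, f g • ρ g := by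
  simp [Representation.asAlgebraHom_single]

omit [Group G] in
theorem exists_eq_sum_single (x : k[G]) : ∃ f : G → k, x = ∑ g, MonoidAlgebra.single g (f g) := by
  classical
  induction x using MonoidAlgebra.induction_linear with
  | zero => exact ⟨0, by simp⟩
  | add x y hx hy =>
    obtain ⟨f, rfl⟩ := hx
    obtain ⟨f', rfl⟩ := hy
    exact ⟨f + f', by simp [Finset.sum_add_distrib]⟩
  | single g a =>
    refine ⟨Pi.single g a, ?_⟩
    rw [Finset.sum_eq_single g (fun h _ hh => by simp [Pi.single_eq_of_ne hh]) (by simp)]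
    simp

/-- A trace-one endomorphism is used instead of the identity because dimensions may vanish in `k`.
This replaces character orthogonality in characteristic `p`. -/
theorem exists_sum_mul_character_eq_ite [IsAlgClosed k] {ι : Type*} [Finite ι] {V : ι → Type*}
    [∀ i, AddCommGroup (V i)] [∀ i, Module k (V i)] [∀ i, FiniteDimensional k (V i)]
    (ρ : ∀ i, Representation k G (V i)) (hirr : ∀ i, (ρ i).IsIrreducible)
    (hne : ∀ i j, i ≠ j → IsEmpty ((ρ i).Equiv (ρ j))) (i₀ : ι) :
    ∃ x : G → k, ∑ g, x g * (ρ i₀).character g = 1 ∧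
      ∀ i, i ≠ i₀ → ∑ g, x g * (ρ i).character g = 0 := by
  classical
  cases nonempty_fintype ι
  have hs : ∀ i, IsSimpleModule k[G] (ρ i).asModule := fun i => inferInstance
  have : Nontrivial (ρ i₀).asModule := IsSimpleModule.nontrivial k[G] _
  obtain ⟨E, hE⟩ := exists_trace_eq_one k (ρ i₀).asModule
  obtain ⟨x, hx, hx'⟩ := exists_smul_eq_of_pairwise_not_linearEquiv (F := k) (A := k[G])
    (M := fun i => (ρ i).asModule) (fun i j hij => ⟨fun e => (hne i j hij).false
      (Representation.IntertwiningMap.ofBijective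
        ((Representation.IntertwiningMap.equivLinearMapAsModule _ _).symm e.toLinearMap)
        e.bijective)⟩) i₀ E
  obtain ⟨f, rfl⟩ := exists_eq_sum_single x
  have key : ∀ i, ∑ g, f g * (ρ i).character g = LinearMap.trace k (V i)
      ((ρ i).asAlgebraHom (∑ g, MonoidAlgebra.single g (f g))) := fun i => by
    rw [asAlgebraHom_sum_single]
    simp [Representation.character]
  refine ⟨f, ?_, fun i hi => ?_⟩
  · rw [key, ← hE]
    exact congrArg (LinearMap.trace k (V i₀)) (LinearMap.ext hx)
  · rw [key, show (ρ i).asAlgebraHom (∑ g, MonoidAlgebra.single g (f g)) = 0 from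
      LinearMap.ext (hx' i hi), map_zero]

/-- The representation of `G` on a `k[G]`-module. -/
def repOfModule (M : Type*) [AddCommGroup M] [Module k M] [Module k[G] M] [IsScalarTower k k[G] M] :
    Representation k G M :=
  ((Algebra.lsmul k k M : k[G] →ₐ[k] End k M) : k[G] →* End k M).comp (MonoidAlgebra.of k G)

omit [Fintype G] in
theorem repOfModule_asAlgebraHom {M : Type*} [AddCommGroup M] [Module k M] [Module k[G] M]
    [IsScalarTower k k[G] M] (x : k[G]) (m : M) :
    (repOfModule (k := k) (G := G) M).asAlgebraHom x m = x • m := by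
  induction x using MonoidAlgebra.induction_linear with
  | zero => simp
  | add x y hx hy => rw [map_add, LinearMap.add_apply, hx, hy, add_smul]
  | single g a =>
    rw [Representation.asAlgebraHom_single, LinearMap.smul_apply,
      show MonoidAlgebra.single g a = a • MonoidAlgebra.of k G g by simp, smul_assoc]
    rfl

omit [Fintype G] in
theorem repOfModule_isIrreducible {M : Type*} [AddCommGroup M] [Module k M] [Module k[G] M]
    [IsScalarTower k k[G] M] [IsSimpleModule k[G] M] :
    (repOfModule (k := k) (G := G) M).IsIrreducible := by
  rw [Representation.irreducible_iff_isSimpleModule_asModule]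
  let e : (repOfModule (k := k) (G := G) M).asModule ≃ₗ[k[G]] M :=
    { toFun := fun m => m
      invFun := fun m => m
      left_inv := fun _ => rfl
      right_inv := fun _ => rfl
      map_add' := fun _ _ => rfl
      map_smul' := fun x m => repOfModule_asAlgebraHom (M := M) x m }
  exact IsSimpleModule.congr e

/-- A class function orthogonal to all irreducible characters vanishes. -/
theorem eq_zero_of_forall_sum_mul_character_eq_zero [IsAlgClosed k] [CharZero k] (f : G → k)
    (hf : ∀ g h, f (h * g * h⁻¹) = f g)
    (h0 : ∀ (n : ℕ) (σ : Representation k G (Fin n → k)), σ.IsIrreducible →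
      ∑ g, f g * σ.character g = 0) : f = 0 := by
  classical
  -- Since `f` is a class function, `z` is central and acts on each simple submodule by a scalar
  -- `c`. The hypothesis gives `c * dim = 0`, so `c = 0` in characteristic zero. By Maschke, `z`
  -- then kills all of `k[G]`.
  set z : k[G] := ∑ g, MonoidAlgebra.single g (f g) with hz
  have hcent : ∀ x : k[G], z * x = x * z := by
    intro x
    induction x using MonoidAlgebra.induction_linear with
    | zero => simp
    | add x y hx hy => rw [mul_add, add_mul, hx, hy]
    | single h a =>
      rw [hz, Finset.sum_mul, Finset.mul_sum, ← (MulAut.conj h).toEquiv.sum_comp]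
      refine Finset.sum_congr rfl fun g _ => ?_
      simp [MonoidAlgebra.single_mul_single, hf, mul_comm]
  have hS : ∀ S : Submodule k[G] k[G], IsSimpleModule k[G] S → ∀ x ∈ S, z * x = 0 := by
    intro S hS x hx
    let l : End k[G] S :=
      { toFun := fun v => z • v
        map_add' := fun v w => smul_add _ _ _
        map_smul' := fun y v => by rw [smul_smul, hcent, ← smul_smul]; rfl }
    obtain ⟨c, hc⟩ := (IsSimpleModule.algebraMap_end_bijective_of_isAlgClosed (A := k[G])
      (V := S) k).2 l
    have hc' : ∀ v : S, z • v = c • v := fun v => (LinearMap.congr_fun hc v).symm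
    obtain ⟨n, σ, ⟨e⟩⟩ := exists_equiv_fin (repOfModule (k := k) (G := G) S)
    have h1 := h0 n σ (isIrreducible_of_equiv e repOfModule_isIrreducible)
    have h2 : LinearMap.trace k S ((repOfModule (k := k) (G := G) S).asAlgebraHom z) = 0 := by
      rw [hz, asAlgebraHom_sum_single, ← h1, ← Representation.char_iso e]
      simp [Representation.character]
    have h3 : (repOfModule (k := k) (G := G) S).asAlgebraHom z = c • 1 :=
      LinearMap.ext fun v => by rw [repOfModule_asAlgebraHom, hc']; rfl
    have : Nontrivial S := IsSimpleModule.nontrivial k[G] _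
    rw [h3, map_smul, LinearMap.trace_one, smul_eq_mul] at h2
    have hc0 : c = 0 := (mul_eq_zero.1 h2).resolve_right
      (Nat.cast_ne_zero.2 (finrank_pos (R := k) (M := S)).ne')
    have := hc' ⟨x, hx⟩
    rw [hc0, zero_smul] at this
    exact congrArg Subtype.val this
  have hall : ∀ x : k[G], z * x = 0 := by
    have : NeZero (Nat.card G : k) := ⟨Nat.cast_ne_zero.2 Nat.card_pos.ne'⟩
    let l : k[G] →ₗ[k[G]] k[G] :=
      { toFun := fun x => z * x
        map_add' := mul_add z
        map_smul' := fun y x => by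
          change z * (y * x) = y * (z * x)
          rw [← mul_assoc, hcent, mul_assoc] }
    have htop : sSup {m : Submodule k[G] k[G] | IsSimpleModule k[G] m} ≤ LinearMap.ker l :=
      sSup_le fun S hS' x hx => hS S hS' x hx
    rw [IsSemisimpleModule.sSup_simples_eq_top] at htop
    exact fun x => htop (Submodule.mem_top (x := x))
  have hz0 : z = 0 := by rw [← mul_one z, hall]
  funext g
  have := congrArg (fun x : k[G] => x.coeff g) hz0
  simpa [hz, MonoidAlgebra.coeff_sum, Finsupp.finsetSum_apply, Finsupp.single_apply] using this

end

/-! ### The inner product on functions. -/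

section innerProduct

variable {G : Type*} [Fintype G]

/-- The inner product as a linear function of its left argument. -/
def ipLeft (mu : G → ℂ) : (G → ℂ) →ₗ[ℂ] ℂ where
  toFun lam := ip lam mu
  map_add' x y := by simp [ip, add_mul, Finset.sum_add_distrib, mul_add]
  map_smul' c x := by
    simp only [ip, Pi.smul_apply, smul_eq_mul, RingHom.id_apply, mul_assoc, ← Finset.mul_sum]
    ring

/-- The inner product as a conjugate-linear function of its right argument. -/
def ipRight (lam : G → ℂ) : (G → ℂ) →ₛₗ[starRingEnd ℂ] ℂ where
  toFun mu := ip lam mu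
  map_add' x y := by simp [ip, Finset.sum_add_distrib, mul_add]
  map_smul' c x := by
    simp only [ip, Pi.smul_apply, smul_eq_mul, map_mul, mul_left_comm _ ((starRingEnd ℂ) c),
      ← Finset.mul_sum]

theorem ipLeft_apply (lam mu : G → ℂ) : ipLeft mu lam = ip lam mu := rfl

theorem ipRight_apply (lam mu : G → ℂ) : ipRight lam mu = ip lam mu := rfl

theorem ip_sub_right (lam x y : G → ℂ) : ip lam (x - y) = ip lam x - ip lam y :=
  map_sub (ipRight lam) x y

theorem ip_zero_right (lam : G → ℂ) : ip lam 0 = 0 := map_zero (ipRight lam)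

theorem ip_smul_left (c : ℂ) (x mu : G → ℂ) : ip (c • x) mu = c * ip x mu :=
  map_smul (ipLeft mu) c x

theorem ip_zsmul_left (c : ℤ) (x mu : G → ℂ) : ip (c • x) mu = c * ip x mu := by
  rw [← ipLeft_apply, map_zsmul, zsmul_eq_mul, ipLeft_apply]

theorem ip_zsmul_right (c : ℤ) (x lam : G → ℂ) : ip lam (c • x) = c * ip lam x := by
  rw [← ipRight_apply, map_zsmul, zsmul_eq_mul, ipRight_apply]

theorem ip_nsmul_right (c : ℕ) (x lam : G → ℂ) : ip lam (c • x) = c * ip lam x := by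
  rw [← ipRight_apply, map_nsmul, nsmul_eq_mul, ipRight_apply]

theorem ip_sum_left {ι : Type*} (s : Finset ι) (x : ι → G → ℂ) (mu : G → ℂ) :
    ip (∑ i ∈ s, x i) mu = ∑ i ∈ s, ip (x i) mu := map_sum (ipLeft mu) x s

theorem ip_sum_right {ι : Type*} (s : Finset ι) (x : ι → G → ℂ) (lam : G → ℂ) :
    ip lam (∑ i ∈ s, x i) = ∑ i ∈ s, ip lam (x i) := map_sum (ipRight lam) x s

theorem eq_zero_of_ip_self_eq_zero [Nonempty G] {f : G → ℂ} (h : ip f f = 0) : f = 0 := by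
  have h1 : ∑ g, f g * (starRingEnd ℂ) (f g) = 0 :=
    (mul_eq_zero.1 h).resolve_left (by simp)
  have h2 : ∑ g, Complex.normSq (f g) = 0 := by
    have : ((∑ g, Complex.normSq (f g) : ℝ) : ℂ) = 0 := by
      rw [← h1]; push_cast; exact Finset.sum_congr rfl fun g _ => (Complex.mul_conj _).symm
    exact_mod_cast this
  funext g
  have := (Finset.sum_eq_zero_iff_of_nonneg fun g _ => Complex.normSq_nonneg (f g)).1 h2 g
    (Finset.mem_univ g)
  exact Complex.normSq_eq_zero.1 this

end innerProduct

/-! ### Ordinary characters as an orthonormal basis of the class functions. -/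

/-- A function is a class function if it is constant on conjugacy classes. -/
def IsClassFunction {G k : Type*} [Group G] (f : G → k) : Prop :=
  ∀ g h, f (h * g * h⁻¹) = f g

theorem IsClassFunction.hat {G : Type*} [Group G] {f : G → ℂ} (hf : IsClassFunction f) (p : ℕ) :
    IsClassFunction (hat p f) := fun g h => by
  simp only [ModRep.hat, hf g h]
  rw [← MulAut.conj_apply, MulEquiv.orderOf_eq]

instance isAlgClosed_AlgNum : IsAlgClosed AlgNum :=
  (algebraicClosure.isAlgClosure (F := ℚ) (E := ℂ)).1

theorem isClassFunction_of_mem_Irr {G : Type*} [Group G] {χ : G → ℂ} (h : χ ∈ Irr G) :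
    IsClassFunction χ := by
  obtain ⟨n, ρ, -, rfl⟩ := h
  intro g h
  simp only [Representation.char_conj]

section

variable {G : Type*} [Group G] [Fintype G]

/-- The eigenvalues of `ρ g` are roots of unity, whose conjugates are their inverses, and `g⁻¹` is
the power `g ^ (orderOf g - 1)`. -/
theorem conj_character {n : ℕ} (ρ : Representation AlgNum G (Fin n → AlgNum)) (g : G) :
    (starRingEnd ℂ) (ρ.character g : ℂ) = (ρ.character g⁻¹ : ℂ) := by
  have hN : orderOf g ≠ 0 := (orderOf_pos g).ne'
  have hf : ρ g ^ orderOf g = 1 := by rw [← map_pow, pow_orderOf_eq_one, map_one]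
  obtain ⟨s, hs, ht⟩ := exists_trace_pow_eq_sum (ρ g) hN hf
  have hinv : g⁻¹ = g ^ (orderOf g - 1) := by
    rw [inv_eq_iff_mul_eq_one, ← pow_succ', Nat.sub_add_cancel (orderOf_pos g), pow_orderOf_eq_one]
  have h1 := ht 1
  rw [pow_one] at h1
  rw [Representation.character, Representation.character, hinv, map_pow, ht, h1]
  have hcoe : ∀ m : Multiset AlgNum, ((m.sum : AlgNum) : ℂ) = (m.map fun u : AlgNum => (u : ℂ)).sum :=
    fun m => map_multiset_sum (algebraMap AlgNum ℂ) m
  rw [hcoe, hcoe, map_multiset_sum, Multiset.map_map, Multiset.map_map, Multiset.map_map]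
  congr 1
  refine Multiset.map_congr rfl fun u hu => ?_
  have hu1 : (u : ℂ) ^ orderOf g = 1 := by
    exact_mod_cast congrArg (fun x : AlgNum => (x : ℂ)) (hs u hu)
  have hn : ‖(u : ℂ)‖ = 1 := Complex.norm_eq_one_of_pow_eq_one hu1 hN
  simp only [Function.comp_apply, pow_one]
  have : (u : ℂ) * (starRingEnd ℂ) (u : ℂ) = 1 := by
    rw [Complex.mul_conj, Complex.normSq_eq_norm_sq, hn]
    simp
  rw [eq_inv_of_mul_eq_one_right this]
  refine inv_eq_of_mul_eq_one_right ?_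
  push_cast
  rw [← pow_succ', Nat.sub_add_cancel (orderOf_pos g), hu1]

theorem ip_character {n m : ℕ} (ρ : Representation AlgNum G (Fin n → AlgNum))
    (σ : Representation AlgNum G (Fin m → AlgNum)) :
    ip (fun g => (ρ.character g : ℂ)) (fun g => (σ.character g : ℂ)) =
      (((Nat.card G : AlgNum)⁻¹ * ∑ g, ρ.character g * σ.character g⁻¹ : AlgNum) : ℂ) := by
  simp only [ip, conj_character]
  push_cast
  rw [Nat.card_eq_fintype_card]

theorem ip_Irr_self {χ : G → ℂ} (hχ : χ ∈ Irr G) : ip χ χ = 1 := by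
  classical
  obtain ⟨n, ρ, hρ, rfl⟩ := hχ
  have : Invertible (Nat.card G : AlgNum) := invertibleOfNonzero (by simp)
  rw [ip_character, Representation.char_orthonormal, if_pos ⟨Representation.Equiv.refl ρ⟩]
  rfl

theorem ip_Irr_of_ne {χ ψ : G → ℂ} (hχ : χ ∈ Irr G) (hψ : ψ ∈ Irr G) (hne : χ ≠ ψ) :
    ip χ ψ = 0 := by
  classical
  obtain ⟨n, ρ, hρ, rfl⟩ := hχ
  obtain ⟨m, σ, hσ, rfl⟩ := hψ
  have : Invertible (Nat.card G : AlgNum) := invertibleOfNonzero (by simp)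
  rw [ip_character, Representation.char_orthonormal, if_neg]
  · rfl
  · rintro ⟨e⟩
    exact hne (by rw [Representation.char_iso e])

theorem ip_Irr [DecidableEq (Irr G)] (χ ψ : Irr G) :
    ip (χ : G → ℂ) (ψ : G → ℂ) = if χ = ψ then 1 else 0 := by
  split_ifs with h
  · rw [h, ip_Irr_self ψ.2]
  · exact ip_Irr_of_ne χ.2 ψ.2 fun h' => h (Subtype.ext h')

theorem linearIndependent_Irr : LinearIndependent ℂ (fun χ : Irr G => (χ : G → ℂ)) := by
  classical
  rw [linearIndependent_iff']
  intro s c hc ψ hψ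
  have := congrArg (fun f => ip f (ψ : G → ℂ)) hc
  simp only [ip_sum_left, ip_smul_left, ip_Irr] at this
  rw [← ipLeft_apply, map_zero] at this
  simpa [hψ] using this

instance finite_Irr : Finite (Irr G) := linearIndependent_Irr.finite

instance fintype_Irr : Fintype (Irr G) := Fintype.ofFinite _

theorem eq_zero_of_forall_ip_Irr_eq_zero {f : G → ℂ} (hf : IsClassFunction f)
    (h0 : ∀ χ ∈ Irr G, ip f χ = 0) : f = 0 := by
  -- The values of `f` are complex while completeness is known over `AlgNum`. Each `AlgNum`-linear
  -- functional on `ℂ` reduces to that case, and these functionals separate points.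
  have key : ∀ l : ℂ →ₗ[AlgNum] AlgNum, (fun g => l (f g⁻¹)) = 0 := by
    intro l
    refine eq_zero_of_forall_sum_mul_character_eq_zero _ (fun g h => ?_) fun n σ hσ => ?_
    · have := hf g⁻¹ h
      simp only [mul_inv_rev, inv_inv]
      rw [← mul_assoc, this]
    · have h1 := h0 _ ⟨n, σ, hσ, rfl⟩
      have h2 : ∑ g, (σ.character g) • f g⁻¹ = 0 := by
        rw [← Equiv.sum_comp (Equiv.inv G)]
        have := (mul_eq_zero.1 h1).resolve_left (by simp)
        simp only [conj_character] at this
        simpa [IntermediateField.smul_def, mul_comm] using this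
      have := congrArg l h2
      rw [map_sum, map_zero] at this
      simpa [mul_comm] using this
  funext g
  refine (Module.forall_dual_apply_eq_zero_iff AlgNum (f g)).1 fun l => ?_
  simpa using congrFun (key l) g⁻¹

theorem eq_sum_ip_Irr {f : G → ℂ} (hf : IsClassFunction f) :
    f = ∑ χ : Irr G, ip f χ • (χ : G → ℂ) := by
  classical
  rw [← sub_eq_zero]
  refine eq_zero_of_forall_ip_Irr_eq_zero (fun g h => ?_) fun χ hχ => ?_
  · simp only [Pi.sub_apply, Finset.sum_apply, Pi.smul_apply, hf g h]
    refine congrArg _ (Finset.sum_congr rfl fun χ _ => ?_)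
    rw [isClassFunction_of_mem_Irr χ.2 g h]
  · lift χ to Irr G using hχ
    rw [← ipLeft_apply, map_sub, ipLeft_apply, ipLeft_apply, ip_sum_left]
    simp [ip_smul_left, ip_Irr]

end

/-! ### The residue field `F = R/I` and valuation rings dominating `(R, I)`. -/

section residue

variable (p : ℕ) (I : Ideal AlgInt) [I.IsMaximal]

theorem red_surjective : Function.Surjective (red I) := Ideal.Quotient.mk_surjective

theorem red_eq_zero_iff (r : AlgInt) : red I r = 0 ↔ r ∈ I := Ideal.Quotient.eq_zero_iff_mem

variable {p I} in
theorem charP_resField [hp : Fact p.Prime] (hpI : (p : AlgInt) ∈ I) : CharP (ResField I) p := by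
  have h0 : ((p : ℕ) : ResField I) = 0 := by
    rw [← map_natCast (red I), red_eq_zero_iff]; exact hpI
  obtain ⟨q, hq⟩ := CharP.exists (ResField I)
  have hqp : q ∣ p := (CharP.cast_eq_zero_iff (ResField I) q p).1 h0
  rcases (Nat.dvd_prime hp.out).1 hqp with h | h
  · exact absurd h (CharP.char_ne_one (ResField I) q)
  · rwa [h] at hq

/-- A complex root is integral over `R`, hence over `ℤ`, so it already lies in `R`. -/
theorem exists_root_of_monic {q : AlgInt[X]} (hq : q.Monic) (hd : q.natDegree ≠ 0) :
    ∃ r : AlgInt, q.eval r = 0 := by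
  have hq' : (q.map (algebraMap AlgInt ℂ)).Monic := hq.map _
  obtain ⟨z, hz⟩ := IsAlgClosed.exists_root (q.map (algebraMap AlgInt ℂ)) (by
    rw [hq.degree_map, degree_eq_natDegree hq.ne_zero]; exact_mod_cast hd)
  have hzi : IsIntegral AlgInt z := ⟨q, hq, by rw [← eval_map]; exact hz⟩
  have hzz : IsIntegral ℤ z := isIntegral_trans (R := ℤ) (A := AlgInt) z hzi
  refine ⟨⟨z, hzz⟩, ?_⟩
  apply Subtype.val_injective
  rw [IsRoot, eval_map, show z = algebraMap AlgInt ℂ ⟨z, hzz⟩ from rfl, eval₂_at_apply] at hz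
  exact hz

instance isAlgClosed_resField : IsAlgClosed (ResField I) := by
  refine IsAlgClosed.of_exists_root _ fun f hf hirr => ?_
  obtain ⟨q, hq, hd, hm⟩ := lifts_and_natDegree_eq_and_monic
    ((mem_lifts f).2 (map_surjective _ (red_surjective I) f)) hf
  obtain ⟨r, hr⟩ := exists_root_of_monic hm (by rw [hd]; exact hirr.natDegree_pos.ne')
  exact ⟨red I r, by rw [← hq, eval_map, eval₂_at_apply, hr, map_zero]⟩

/-- The inclusion of the algebraic integers into the algebraic numbers. -/
def toAlgNum : AlgInt →+* AlgNum :=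
  (algebraMap AlgInt ℂ).codRestrict AlgNum fun r =>
    mem_algebraicClosure_iff.2 ((IsIntegral.tower_top (A := ℚ) r.2).isAlgebraic)

theorem toAlgNum_injective : Function.Injective toAlgNum := fun _ _ h =>
  Subtype.ext (congrArg (fun x : AlgNum => (x : ℂ)) h)

variable {I} in
theorem exists_valuationSubring_dominating {K : Type*} [Field K] {f : AlgInt →+* K}
    (hf : Function.Injective f) : ∃ V : ValuationSubring K, (∀ r, f r ∈ V) ∧
      ∀ r ∈ I, f r ∈ V.nonunits := by
  obtain ⟨V, hV, hI⟩ := Ideal.image_subset_nonunits_valuationSubring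
    (I.map f.rangeRestrict) (fun h => by
      have hmem : f.rangeRestrict 1 ∈ I.map f.rangeRestrict := by rw [h]; trivial
      obtain ⟨x, hx, hx1⟩ := (Ideal.mem_map_iff_of_surjective _ f.rangeRestrict_surjective).1 hmem
      have hx1 : x = 1 := hf (congrArg Subtype.val hx1)
      exact Ideal.IsPrime.ne_top (I := I) inferInstance
        ((Ideal.eq_top_iff_one I).2 (hx1 ▸ hx)))
  exact ⟨V, fun r => hV ⟨r, rfl⟩, fun r hr => hI ⟨_, Ideal.mem_map_of_mem _ hr, rfl⟩⟩

/-- The map from `R/I` to the residue field of a valuation ring dominating `(R, I)`. -/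
def resMap {K : Type*} [Field K] (f : AlgInt →+* K) (V : ValuationSubring K) (hV : ∀ r, f r ∈ V)
    (hI : ∀ r ∈ I, f r ∈ V.nonunits) : ResField I →+* IsLocalRing.ResidueField V :=
  Ideal.Quotient.lift I ((IsLocalRing.residue V).comp (f.codRestrict V hV)) fun r hr => by
    rw [RingHom.comp_apply, IsLocalRing.residue_eq_zero_iff]
    have : f r ∈ (V.nonunits : Set K) := hI r hr
    rw [← ValuationSubring.image_maximalIdeal] at this
    obtain ⟨x, hx, hxr⟩ := this
    rwa [show f.codRestrict V hV r = x from Subtype.ext hxr.symm]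

theorem resMap_red {K : Type*} [Field K] (f : AlgInt →+* K) (V : ValuationSubring K)
    (hV : ∀ r, f r ∈ V) (hI : ∀ r ∈ I, f r ∈ V.nonunits) (r : AlgInt) :
    resMap I f V hV hI (red I r) = IsLocalRing.residue V ⟨f r, hV r⟩ := rfl

omit p I in
-- Every element of `V` is a root of a primitive integer polynomial, which stays nonzero modulo `p`.
-- The residue field is thus algebraic over the algebraically closed field `F`.
theorem bijective_residueField_of_charP (p : ℕ) [hp : Fact p.Prime] {F : Type*} [Field F]
    [IsAlgClosed F] [CharP F p] (V : ValuationSubring AlgNum)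
    (φ : F →+* IsLocalRing.ResidueField V) : Function.Bijective φ := by
  let _ : Algebra F (IsLocalRing.ResidueField V) := φ.toAlgebra
  have halg : Algebra.IsAlgebraic F (IsLocalRing.ResidueField V) := by
    refine ⟨fun y => ?_⟩
    obtain ⟨x, rfl⟩ := IsLocalRing.residue_surjective y
    have hx : IsAlgebraic ℚ ((x : AlgNum) : ℂ) := mem_algebraicClosure_iff.1 (x : AlgNum).2
    obtain ⟨q, hq0, hq⟩ := (IsFractionRing.isAlgebraic_iff ℤ ℚ ℂ).2 hx
    have hq' : aeval ((x : AlgNum) : ℂ) q.primPart = 0 := by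
      rw [q.eq_C_content_mul_primPart, map_mul, aeval_C] at hq
      refine (mul_eq_zero.1 hq).resolve_left ?_
      simpa using content_eq_zero_iff.not.2 hq0
    have hqx : eval₂ (Int.castRingHom V) x q.primPart = 0 := by
      have hj : Function.Injective ((algebraMap AlgNum ℂ).comp V.subtype) := fun a b h =>
        Subtype.ext ((algebraMap AlgNum ℂ).injective h)
      apply hj
      rw [hom_eval₂, map_zero, ← hq', aeval_def]
      rfl
    have hq0 : q.primPart.map (Int.castRingHom F) ≠ 0 := by
      intro h0
      have hdvd : C (p : ℤ) ∣ q.primPart := by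
        rw [C_dvd_iff_dvd_coeff]
        intro i
        have := congrArg (fun f => f.coeff i) h0
        rw [coeff_map] at this
        exact (CharP.intCast_eq_zero_iff F p _).1 this
      have := isPrimitive_iff_isUnit_of_C_dvd.1 q.isPrimitive_primPart _ hdvd
      rw [Int.isUnit_iff] at this
      have := hp.out.two_le
      omega
    refine ⟨_, hq0, ?_⟩
    have := congrArg (IsLocalRing.residue V) hqx
    rw [hom_eval₂, map_zero] at this
    rw [aeval_def, eval₂_map, ← this]
    congr 1
    exact RingHom.ext_int _ _
  exact IsAlgClosed.algebraMap_bijective_of_isIntegral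

variable {p I} in
-- Extends `R → F` to a valuation ring of `K`, with no growth of the residue field. Over a valuation
-- ring lattices are free, so representations can be written integrally.
theorem exists_valuationSubring_and_reduction [Fact p.Prime] (hpI : (p : AlgInt) ∈ I) :
    ∃ (V : ValuationSubring AlgNum) (hV : ∀ r, toAlgNum r ∈ V) (π : V →+* ResField I),
      ∀ r, π ⟨toAlgNum r, hV r⟩ = red I r := by
  obtain ⟨V, hV, hI⟩ := exists_valuationSubring_dominating (I := I) toAlgNum_injective
  have := charP_resField hpI
  let e : ResField I ≃+* IsLocalRing.ResidueField V :=
    RingEquiv.ofBijective _ (bijective_residueField_of_charP p V (resMap I toAlgNum V hV hI))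
  refine ⟨V, hV, (e.symm : _ →+* _).comp (IsLocalRing.residue V), fun r => ?_⟩
  rw [RingHom.comp_apply, ← resMap_red I toAlgNum V hV hI r]
  exact (RingEquiv.symm_apply_eq e).2 rfl

end residue

/-! ### Lifting `p'`-roots of unity. -/

section rootLift

variable {G : Type*} [Group G] {p : ℕ} {I : Ideal AlgInt} [I.IsMaximal]

variable (G p) in
/-- The `p'`-part of the group order. -/
def cardPrimeTo : ℕ := Nat.card G / p ^ (Nat.card G).factorization p

theorem pow_cardPrimeTo_eq_one [Finite G] {g : G} (hg : ¬ p ∣ orderOf g) :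
    g ^ cardPrimeTo G p = 1 :=
  orderOf_dvd_iff_pow_eq_one.1
    (Nat.dvd_ordCompl_of_dvd_not_dvd (orderOf_dvd_natCard g) hg)

theorem cardPrimeTo_ne_zero_cast [Finite G] [hp : Fact p.Prime] (hpI : (p : AlgInt) ∈ I) :
    (cardPrimeTo G p : ResField I) ≠ 0 := by
  have := charP_resField hpI
  rw [Ne, CharP.cast_eq_zero_iff (ResField I) p]
  exact Nat.not_dvd_ordCompl hp.out Nat.card_pos.ne'

/-- Reduction is injective on the roots of unity in question because their exponent is invertible in
`F`; hence the `epsilon` choice has only one candidate. -/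
theorem rootLift_red [Finite G] [Fact p.Prime] (hpI : (p : AlgInt) ∈ I) {u : AlgInt}
    (hu : u ^ cardPrimeTo G p = 1) : rootLift G p I (red I u) = u := by
  have hex : ∃ v : AlgInt, v ^ cardPrimeTo G p = 1 ∧ red I v = red I u := ⟨u, hu, rfl⟩
  obtain ⟨hv, hvu⟩ : rootLift G p I (red I u) ^ cardPrimeTo G p = 1 ∧
    red I (rootLift G p I (red I u)) = red I u := Classical.epsilon_spec hex
  generalize rootLift G p I (red I u) = v at hv hvu
  have hm : cardPrimeTo G p ≠ 0 := fun h =>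
    cardPrimeTo_ne_zero_cast (G := G) hpI (by rw [h, Nat.cast_zero])
  by_contra hne
  -- the quotient `w = v / u` is a root of `1 + X + ... + X ^ (m - 1)` congruent to `1`
  set w := v * u ^ (cardPrimeTo G p - 1) with hw
  have hu' : u ^ (cardPrimeTo G p - 1) * u = 1 := by
    rw [← pow_succ, Nat.sub_add_cancel (Nat.pos_of_ne_zero hm), hu]
  have hwm : w ^ cardPrimeTo G p = 1 := by
    rw [hw, mul_pow, hv, ← pow_mul, mul_comm _ (cardPrimeTo G p), pow_mul, hu, one_pow, one_mul]
  have hw1 : w ≠ 1 := fun h => hne (by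
    calc v = v * (u ^ (cardPrimeTo G p - 1) * u) := by rw [hu', mul_one]
      _ = w * u := by rw [hw, mul_assoc]
      _ = u := by rw [h, one_mul])
  have hwr : red I w = 1 := by
    rw [hw, map_mul, hvu, ← map_mul, mul_comm, hu', map_one]
  have hgeom : ∑ i ∈ Finset.range (cardPrimeTo G p), w ^ i = 0 := by
    have := geom_sum_mul w (cardPrimeTo G p)
    rw [hwm, sub_self] at this
    exact (mul_eq_zero.1 this).resolve_right (sub_ne_zero.2 hw1)
  have := congrArg (red I) hgeom
  rw [map_sum, map_zero] at this
  simp only [map_pow, hwr, one_pow, Finset.sum_const, Finset.card_range, nsmul_eq_mul,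
    mul_one] at this
  exact cardPrimeTo_ne_zero_cast hpI this

end rootLift

/-! ### Stable lattices over a valuation ring. -/

section lattice

variable {K G : Type*} [Field K] [Group G] [Finite G] (V : ValuationSubring K) {n : ℕ}

omit [Finite G] in
variable (G n) in
/-- The submodule over a valuation ring spanned by the translates of the standard basis. -/
def translateSpan (ρ : Representation K G (Fin n → K)) : Submodule V (Fin n → K) :=
  Submodule.span V (Set.range fun x : G × Fin n => ρ x.1 (Pi.single x.2 1))

theorem translateSpan_isLattice (ρ : Representation K G (Fin n → K)) :
    Submodule.IsLattice K (translateSpan G V n ρ) where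
  fg := Submodule.fg_span (Set.finite_range _)
  span_eq_top := by
    rw [translateSpan, Submodule.span_span_of_tower, eq_top_iff, ← (Pi.basisFun K (Fin n)).span_eq]
    refine Submodule.span_mono ?_
    rintro _ ⟨i, rfl⟩
    exact ⟨(1, i), by simp⟩

omit [Finite G] in
theorem apply_mem_translateSpan (ρ : Representation K G (Fin n → K)) (g : G) {x : Fin n → K}
    (hx : x ∈ translateSpan G V n ρ) : ρ g x ∈ translateSpan G V n ρ := by
  have : translateSpan G V n ρ ≤ (translateSpan G V n ρ).comap ((ρ g).restrictScalars V) := by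
    rw [translateSpan, Submodule.span_le]
    rintro _ ⟨⟨h, i⟩, rfl⟩
    refine Submodule.subset_span ⟨(g * h, i), ?_⟩
    simp
  exact this hx

/-- The span of the translates of the standard basis is a finitely generated, torsion-free,
`G`-stable lattice. Over a valuation ring it is flat and therefore free, and a basis of it is also a
`K`-basis of the whole space. -/
theorem exists_matrix_over_valuationSubring (ρ : Representation K G (Fin n → K)) :
    ∃ M : G →* Matrix (Fin n) (Fin n) V, ∀ g, ((M g).charpoly).map V.subtype = (ρ g).charpoly := by
  classical
  let L := translateSpan G V n ρ
  have hL : Submodule.IsLattice K L := translateSpan_isLattice V ρ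
  have hflat : Module.Flat V L := by
    rw [Module.Flat.flat_iff_torsion_eq_bot_of_isBezout, eq_bot_iff]
    rintro x ⟨⟨r, hr⟩, hx⟩
    have hr0 : (r : K) ≠ 0 := fun h => nonZeroDivisors.ne_zero hr (Subtype.ext h)
    have hx' : (r : K) • (x : Fin n → K) = 0 := congrArg Subtype.val hx
    exact Subtype.ext ((smul_eq_zero.1 hx').resolve_left hr0)
  have hfree : Module.Free V L := Module.free_of_flat_of_isLocalRing
  let b₀ := Module.Free.chooseBasis V L
  let e : Module.Free.ChooseBasisIndex V L ≃ Fin n :=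
    (b₀.extendOfIsLattice K).indexEquiv (Pi.basisFun K (Fin n))
  let b : Basis (Fin n) V L := b₀.reindex e
  let b' : Basis (Fin n) K (Fin n → K) := b.extendOfIsLattice K
  let l : G →* End V L :=
    { toFun := fun g => ((ρ g).restrictScalars V).restrict fun x hx =>
        apply_mem_translateSpan V ρ g hx
      map_one' := by
        refine LinearMap.ext fun x => Subtype.ext ?_
        simp
      map_mul' := fun g h => by
        refine LinearMap.ext fun x => Subtype.ext ?_
        exact LinearMap.congr_fun (map_mul ρ g h) (x : Fin n → K) }
  let M : G →* Matrix (Fin n) (Fin n) V :=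
    ((LinearMap.toMatrixAlgEquiv b : _ ≃ₐ[V] _) : End V L →* Matrix (Fin n) (Fin n) V).comp l
  have hrepr : ∀ (x : L) i, b'.repr (x : Fin n → K) i = (b.repr x i : K) := by
    intro x i
    have hx : (x : Fin n → K) = ∑ j, (b.repr x j : K) • b' j := by
      simp only [b', Basis.extendOfIsLattice_apply]
      exact (congrArg L.subtype (b.sum_repr x)).symm.trans (map_sum L.subtype _ _)
    rw [hx, map_sum, Finsupp.finsetSum_apply]
    simp [Finsupp.single_apply]
  refine ⟨M, fun g => ?_⟩
  rw [← LinearMap.charpoly_toMatrix (ρ g) b', ← Matrix.charpoly_map]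
  congr 1
  ext i j
  rw [LinearMap.toMatrix_apply, show b' j = (b j : Fin n → K) from Basis.extendOfIsLattice_apply ..]
  refine Eq.trans ?_ (hrepr (l g (b j)) i).symm
  exact congrArg V.subtype (LinearMap.toMatrix_apply b b (l g) i j)

end lattice

/-! ### Brauer characters and reduction modulo `I`. -/

theorem pow_eq_one_of_mem_roots_charpoly {k V : Type*} [Field k] [AddCommGroup V] [Module k V]
    [FiniteDimensional k V] {f : End k V} {m : ℕ} (hf : f ^ m = 1) {u : k}
    (hu : u ∈ f.charpoly.roots) : u ^ m = 1 := by
  have hev : f.HasEigenvalue u :=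
    (Module.End.hasEigenvalue_iff_isRoot_charpoly f u).2 (isRoot_of_mem_roots hu)
  obtain ⟨x, hx⟩ := hev.exists_hasEigenvector
  have h := hx.pow_apply m
  rw [hf] at h
  have h0 : (u ^ m - 1) • x = 0 := by rw [sub_smul, ← h]; simp
  exact sub_eq_zero.1 ((smul_eq_zero.1 h0).resolve_right hx.2)

section

variable {G : Type*} [Group G] [Finite G] {p : ℕ} [Fact p.Prime] {I : Ideal AlgInt} [I.IsMaximal]

omit [Finite G] in
-- `X ^ m - 1` splits over `R`; evaluating the reduced factorization at `z` makes some factor `z -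
-- red I u` vanish.
theorem exists_red_eq_of_pow_eq_one {m : ℕ} (hm : m ≠ 0) {z : ResField I} (hz : z ^ m = 1) :
    ∃ u : AlgInt, u ^ m = 1 ∧ red I u = z := by
  have hζ := Complex.isPrimitiveRoot_exp m hm
  obtain ⟨ζ, hζ⟩ : ∃ ζ : AlgInt, IsPrimitiveRoot ζ m := by
    refine ⟨⟨_, hζ.isIntegral (Nat.pos_of_ne_zero hm)⟩, ?_⟩
    exact IsPrimitiveRoot.of_map_of_injective (f := algebraMap AlgInt ℂ) hζ Subtype.val_injective
  have h := congrArg (eval₂ (red I) z) (X_pow_sub_one_eq_prod (Nat.pos_of_ne_zero hm) hζ)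
  rw [eval₂_finsetProd] at h
  simp only [eval₂_sub, eval₂_X_pow, eval₂_one, eval₂_X, eval₂_C, hz, sub_self] at h
  obtain ⟨u, hu, hu0⟩ := Finset.prod_eq_zero_iff.1 h.symm
  exact ⟨u, (mem_nthRootsFinset (Nat.pos_of_ne_zero hm) _).1 hu, (sub_eq_zero.1 hu0).symm⟩

theorem red_rootLift (hpI : (p : AlgInt) ∈ I) {z : ResField I} (hz : z ^ cardPrimeTo G p = 1) :
    red I (rootLift G p I z) = z := by
  obtain ⟨u, hu, rfl⟩ := exists_red_eq_of_pow_eq_one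
    (fun h => cardPrimeTo_ne_zero_cast (G := G) hpI (by rw [h, Nat.cast_zero])) hz
  rw [rootLift_red hpI hu]

omit [Fact p.Prime] in
theorem pow_cardPrimeTo_eq_one_of_mem_roots {k V : Type*} [Field k] [AddCommGroup V] [Module k V]
    [FiniteDimensional k V] (σ : Representation k G V) {g : G} (hg : ¬ p ∣ orderOf g) {u : k}
    (hu : u ∈ (σ g).charpoly.roots) : u ^ cardPrimeTo G p = 1 :=
  pow_eq_one_of_mem_roots_charpoly (by rw [← map_pow, pow_cardPrimeTo_eq_one hg, map_one]) hu

/-- Values of Brauer characters at `p`-regular elements are algebraic integers that lift the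
traces. -/
theorem exists_brauerCharacter_eq (hpI : (p : AlgInt) ∈ I) {n : ℕ}
    (σ : Representation (ResField I) G (Fin n → ResField I)) {g : G} (hg : ¬ p ∣ orderOf g) :
    ∃ r : AlgInt, brauerCharacter p I σ g = r ∧ red I r = σ.character g := by
  refine ⟨((σ g).charpoly.roots.map (rootLift G p I)).sum, ?_, ?_⟩
  · rw [brauerCharacter, if_neg hg]
    refine Eq.trans ?_ (map_multiset_sum (algebraMap AlgInt ℂ) _).symm
    rw [Multiset.map_map]
    rfl
  · rw [map_multiset_sum, Multiset.map_map, Representation.character,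
      Module.End.trace_eq_sum_roots_charpoly_of_splits (IsAlgClosed.splits _)]
    congr 1
    conv_rhs => rw [← Multiset.map_id (σ g).charpoly.roots]
    exact Multiset.map_congr rfl fun z hz =>
      red_rootLift hpI (pow_cardPrimeTo_eq_one_of_mem_roots σ hg hz)

/-- The reduction of an ordinary representation. -/
theorem exists_brauerCharacter_eq_hat (hpI : (p : AlgInt) ∈ I) {n : ℕ}
    (ρ : Representation AlgNum G (Fin n → AlgNum)) :
    ∃ σ : Representation (ResField I) G (Fin n → ResField I),
      brauerCharacter p I σ = hat p fun g => (ρ.character g : ℂ) := by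
  obtain ⟨V, hV, π, hπ⟩ := exists_valuationSubring_and_reduction hpI
  obtain ⟨M, hM⟩ := exists_matrix_over_valuationSubring V ρ
  let σ : Representation (ResField I) G (Fin n → ResField I) :=
    ((Matrix.toLinAlgEquiv' : Matrix (Fin n) (Fin n) (ResField I) ≃ₐ[ResField I] _) :
      Matrix (Fin n) (Fin n) (ResField I) →* End (ResField I) (Fin n → ResField I)).comp
      ((π.mapMatrix (m := Fin n)).toMonoidHom.comp M)
  have hσ : ∀ g, (σ g).charpoly = (M g).charpoly.map π := fun g => by
    rw [← Matrix.charpoly_map]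
    exact Matrix.charpoly_toLin' _
  refine ⟨σ, funext fun g => ?_⟩
  rw [brauerCharacter, hat]
  split_ifs with hg
  · rfl
  -- Eigenvalues at a `p`-regular element are roots of unity, hence algebraic integers, so the
  -- characteristic polynomial splits already over `V` and can be reduced factor by factor.
  obtain ⟨s, hs⟩ : ∃ s : Multiset AlgInt, s.map toAlgNum = (ρ g).charpoly.roots := by
    have hint : ∀ u ∈ (ρ g).charpoly.roots, ∃ r : AlgInt, toAlgNum r = u := fun u hu => by
      have hu1 := pow_cardPrimeTo_eq_one_of_mem_roots ρ hg hu
      have hu2 : (u : ℂ) ^ cardPrimeTo G p = 1 := by rw [← SubmonoidClass.coe_pow, hu1]; rfl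
      have hm : 0 < cardPrimeTo G p := Nat.pos_of_ne_zero fun h =>
        cardPrimeTo_ne_zero_cast (G := G) hpI (by rw [h, Nat.cast_zero])
      refine ⟨⟨u, IsIntegral.of_pow hm (by rw [hu2]; exact isIntegral_one)⟩, Subtype.ext rfl⟩
    have hlift : CanLift AlgNum AlgInt toAlgNum fun u => ∃ r, toAlgNum r = u := ⟨fun _ h => h⟩
    generalize (ρ g).charpoly.roots = t at hint
    lift t to Multiset AlgInt using hint
    exact ⟨t, rfl⟩
  have hs1 : ∀ u ∈ s, u ^ cardPrimeTo G p = 1 := fun u hu => toAlgNum_injective (by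
    rw [map_pow, map_one]
    exact pow_cardPrimeTo_eq_one_of_mem_roots ρ hg (hs ▸ Multiset.mem_map_of_mem _ hu))
  have hMg : (M g).charpoly = (s.map fun u => X - C (⟨toAlgNum u, hV u⟩ : V)).prod := by
    apply map_injective V.subtype Subtype.val_injective
    rw [hM, (IsAlgClosed.splits (ρ g).charpoly).eq_prod_roots_of_monic (LinearMap.charpoly_monic _),
      ← hs, Polynomial.map_multiset_prod, Multiset.map_map, Multiset.map_map]
    simp
  have hroots : (σ g).charpoly.roots = s.map (red I) := by
    rw [hσ, hMg, Polynomial.map_multiset_prod, Multiset.map_map]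
    rw [← roots_multiset_prod_X_sub_C (s.map (red I)), Multiset.map_map]
    congr 2
    exact Multiset.map_congr rfl fun u _ => by simp [hπ]
  rw [hroots, Multiset.map_map, Representation.character,
    Module.End.trace_eq_sum_roots_charpoly_of_splits (IsAlgClosed.splits _), ← hs]
  refine Eq.trans ?_ (map_multiset_sum (algebraMap AlgNum ℂ) _).symm
  rw [Multiset.map_map]
  congr 1
  exact Multiset.map_congr rfl fun u hu => by
    rw [Function.comp_apply, rootLift_red hpI (hs1 u hu)]
    rfl

end

/-! ### Composition series and existence of decomposition numbers. -/

section compositionSeries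

variable {G : Type*} [Group G] (p : ℕ) (I : Ideal AlgInt) [I.IsMaximal]

/-- The Brauer character of a representation on an arbitrary space. -/
def brauerFun {V : Type*} [AddCommGroup V] [Module (ResField I) V]
    [FiniteDimensional (ResField I) V] (ρ : Representation (ResField I) G V) : G → ℂ :=
  fun g => if p ∣ orderOf g then 0
    else ((ρ g).charpoly.roots.map fun z => (rootLift G p I z : ℂ)).sum

theorem brauerFun_eq_brauerCharacter {n : ℕ}
    (ρ : Representation (ResField I) G (Fin n → ResField I)) :
    brauerFun p I ρ = brauerCharacter p I ρ := rfl

theorem brauerFun_eq_of_equiv {V W : Type*} [AddCommGroup V] [Module (ResField I) V]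
    [FiniteDimensional (ResField I) V] [AddCommGroup W] [Module (ResField I) W]
    [FiniteDimensional (ResField I) W] {ρ : Representation (ResField I) G V}
    {σ : Representation (ResField I) G W} (e : ρ.Equiv σ) : brauerFun p I ρ = brauerFun p I σ := by
  funext g
  rw [brauerFun, brauerFun, ← Representation.Equiv.conj_apply_self g e]
  have h : (e.toLinearEquiv.conj (ρ g)).charpoly = (ρ g).charpoly :=
    LinearEquiv.charpoly_conj e.toLinearEquiv (ρ g)
  rw [← h]

theorem brauerFun_eq_add {V : Type*} [AddCommGroup V] [Module (ResField I) V]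
    [FiniteDimensional (ResField I) V] (ρ : Representation (ResField I) G V)
    (W : Subrepresentation ρ) : brauerFun p I ρ = brauerFun p I W.toRepresentation +
      brauerFun p I (ρ.quotient W.toSubmodule W.apply_mem_toSubmodule) := by
  funext g
  simp only [brauerFun, Pi.add_apply]
  split_ifs with h
  · rw [add_zero]
  · rw [← Multiset.sum_add, ← Multiset.map_add, ← roots_mul (mul_ne_zero
      (LinearMap.charpoly_monic _).ne_zero (LinearMap.charpoly_monic _).ne_zero),
      charpoly_eq_mul_charpoly_quotient W.toSubmodule (ρ g) (W.apply_mem_toSubmodule g)]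
    rfl

/-- Induction on the dimension, splitting off a proper nonzero subrepresentation. Arbitrary spaces
are allowed because submodules and quotients of `F ^ n` carry no preferred coordinates. -/
theorem brauerFun_mem_closure_IBr (d : ℕ) : ∀ (V : Type) [AddCommGroup V] [Module (ResField I) V]
    [FiniteDimensional (ResField I) V] (ρ : Representation (ResField I) G V),
    finrank (ResField I) V = d → brauerFun p I ρ ∈ AddSubmonoid.closure (IBr G p I) := by
  induction d using Nat.strong_induction_on with
  | _ d ih =>
  intro V _ _ _ ρ hd
  by_cases hirr : ρ.IsIrreducible
  · obtain ⟨n, σ, ⟨e⟩⟩ := exists_equiv_fin ρ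
    rw [brauerFun_eq_of_equiv p I e]
    exact AddSubmonoid.subset_closure ⟨n, σ, isIrreducible_of_equiv e hirr, rfl⟩
  cases subsingleton_or_nontrivial V with
  | inl hV =>
    have h0 : brauerFun p I ρ = 0 := by
      funext g
      have : (ρ g).charpoly = 1 := by
        rw [← (LinearMap.charpoly_monic _).natDegree_eq_zero, LinearMap.charpoly_natDegree,
          finrank_zero_of_subsingleton]
      rw [brauerFun, this]
      simp
    rw [h0]
    exact AddSubmonoid.zero_mem _
  | inr hV =>
    obtain ⟨W, hbot, htop⟩ : ∃ W : Subrepresentation ρ, W ≠ ⊥ ∧ W ≠ ⊤ := by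
      by_contra! h
      have : Nontrivial (Subrepresentation ρ) := ⟨⊥, ⊤, fun h' =>
        bot_ne_top (α := Submodule (ResField I) V) (congrArg Subrepresentation.toSubmodule h')⟩
      exact hirr ⟨fun W => or_iff_not_imp_left.2 (h W)⟩
    have hbot' : W.toSubmodule ≠ ⊥ := fun h => hbot (Subrepresentation.toSubmodule_injective h)
    have htop' : W.toSubmodule ≠ ⊤ := fun h => htop (Subrepresentation.toSubmodule_injective h)
    have h1 : finrank (ResField I) W.toSubmodule < d := hd ▸ Submodule.finrank_lt htop'
    have h2 : finrank (ResField I) (V ⧸ W.toSubmodule) < d := by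
      have := Submodule.finrank_quotient_add_finrank W.toSubmodule
      have : 0 < finrank (ResField I) W.toSubmodule := by
        rw [Nat.pos_iff_ne_zero, Ne, Submodule.finrank_eq_zero]; exact hbot'
      omega
    rw [brauerFun_eq_add p I ρ W]
    exact AddSubmonoid.add_mem _ (ih _ h1 _ _ rfl) (ih _ h2 _ _ rfl)

end compositionSeries

theorem exists_finsupp_of_mem_closure {M : Type*} [AddCommMonoid M] {S : Set M} {x : M}
    (hx : x ∈ AddSubmonoid.closure S) :
    ∃ d : S →₀ ℕ, x = d.sum fun φ k => k • (φ : M) := by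
  induction hx using AddSubmonoid.closure_induction with
  | mem x hx => exact ⟨Finsupp.single ⟨x, hx⟩ 1, by simp⟩
  | zero => exact ⟨0, by simp⟩
  | add x y _ _ hx hy =>
    obtain ⟨d, rfl⟩ := hx
    obtain ⟨d', rfl⟩ := hy
    exact ⟨d + d', (Finsupp.sum_add_index' (by simp) (by simp [add_smul])).symm⟩

theorem hat_eq_sum_decompositionNumber {G : Type*} [Group G] [Finite G] {p : ℕ} [Fact p.Prime]
    {I : Ideal AlgInt} [I.IsMaximal] (hpI : (p : AlgInt) ∈ I) {χ : G → ℂ} (hχ : χ ∈ Irr G) :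
    hat p χ = (decompositionNumber p I χ).sum fun φ k => k • (φ : G → ℂ) := by
  obtain ⟨n, ρ, -, rfl⟩ := hχ
  obtain ⟨σ, hσ⟩ := exists_brauerCharacter_eq_hat hpI ρ
  refine Classical.epsilon_spec (p := fun d : IBr G p I →₀ ℕ => hat p _ = d.sum fun φ k =>
    k • (φ : G → ℂ)) (exists_finsupp_of_mem_closure ?_)
  rw [← hσ, ← brauerFun_eq_brauerCharacter]
  exact brauerFun_mem_closure_IBr p I _ _ σ rfl

/-! ### Linear independence of the irreducible Brauer characters. -/

section independence

variable {G : Type*} [Group G] [Finite G] {p : ℕ} [Fact p.Prime]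

/-- `h` is the `p`-regular part of `g`: a power `g ^ k` with `k ≡ 0` modulo the `p`-part of the
order and `k ≡ 1` modulo the rest. Then `g` and `h` have the same `p ^ a`-th power. -/
theorem exists_regular_character_eq (p : ℕ) [hp : Fact p.Prime] (g : G) :
    ∃ h : G, ¬ p ∣ orderOf h ∧ ∀ (F V : Type) [Field F] [CharP F p] [AddCommGroup V] [Module F V]
      (σ : Representation F G V), σ.character g = σ.character h := by
  obtain ⟨a, m, hm, ho⟩ := Nat.exists_eq_pow_mul_and_not_dvd (orderOf_pos g).ne' p hp.out.ne_one
  have hcop : (p ^ a).Coprime m :=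
    Nat.Coprime.pow_left a ((Nat.Prime.coprime_iff_not_dvd hp.out).2 hm)
  obtain ⟨k, hk0, hk1⟩ := Nat.chineseRemainder hcop 0 1
  refine ⟨g ^ k, fun h => hm (h.trans ?_), ?_⟩
  · refine orderOf_dvd_of_pow_eq_one ?_
    rw [← pow_mul, ← orderOf_dvd_iff_pow_eq_one, ho]
    exact mul_dvd_mul_right ((Nat.modEq_zero_iff_dvd).1 hk0) m
  · intro F V _ _ _ _ σ
    have hpow : g ^ p ^ a = (g ^ k) ^ p ^ a := by
      rw [← pow_mul, mul_comm, pow_eq_pow_iff_modEq, ho]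
      have := (hk1.mul_left' (p ^ a)).symm
      rwa [mul_one] at this
    refine trace_eq_of_commute_of_pow_char_pow_eq p a ?_ (by rw [← map_pow, ← map_pow, hpow])
    exact (Commute.pow_right (Commute.refl g) k).map σ

/-- A relation is scaled to have coefficients in a valuation ring of `ℂ`, one of them `1`, and
reduced to a relation between trace characters over `F`. It holds at all elements, since traces
depend only on the `p`-regular part. A separating element of the group algebra then gives `1 = 0`.
-/
theorem linearIndependent_IBr {I : Ideal AlgInt} [I.IsMaximal] (hpI : (p : AlgInt) ∈ I) :
    LinearIndependent ℂ (fun φ : IBr G p I => (φ : G → ℂ)) := by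
  classical
  cases nonempty_fintype G
  have := charP_resField hpI
  rw [linearIndependent_iff']
  intro s c hc
  by_contra! hne
  obtain ⟨φ₁, hφ₁, hc₁⟩ := hne
  obtain ⟨V, hV, hI⟩ := exists_valuationSubring_dominating (I := I) (f := algebraMap AlgInt ℂ)
    Subtype.val_injective
  -- Dividing by the coefficient of largest valuation makes all coefficients integral.
  obtain ⟨φ₀, hφ₀, hmax⟩ := s.exists_max_image (fun φ => V.valuation (c φ)) ⟨φ₁, hφ₁⟩
  have hc₀ : c φ₀ ≠ 0 := fun h => hc₁ (by
    have := hmax φ₁ hφ₁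
    rw [h, map_zero, le_zero_iff, map_eq_zero] at this
    exact this)
  have hd : ∀ φ : s, c φ / c φ₀ ∈ V := fun φ => by
    rw [← V.valuation_le_one_iff, map_div₀]
    exact div_le_one_of_le₀ (hmax φ φ.2) zero_le
  let ε := resMap I (algebraMap AlgInt ℂ) V hV hI
  choose n σ hirr hσ using fun φ : s => φ.1.2
  obtain ⟨x, hx₁, hx₀⟩ := exists_sum_mul_character_eq_ite σ hirr (fun i j hij => ⟨fun e => hij
    (Subtype.ext (Subtype.ext (by
      rw [hσ i, hσ j]; exact brauerFun_eq_of_equiv p I e)))⟩) ⟨φ₀, hφ₀⟩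
  have hrel : ∀ g, ∑ φ : s, IsLocalRing.residue V ⟨_, hd φ⟩ * ε ((σ φ).character g) = 0 := by
    intro g
    obtain ⟨h, hh, hgh⟩ := exists_regular_character_eq p g
    choose r hr hrr using fun φ : s => exists_brauerCharacter_eq hpI (σ φ) hh
    have h1 : ∑ φ : s, (⟨_, hd φ⟩ : V) * ⟨r φ, hV (r φ)⟩ = 0 := by
      apply Subtype.val_injective
      have := congrFun hc h
      rw [← Finset.sum_coe_sort, Finset.sum_apply] at this
      have h0 : ∑ φ : s, c φ / c φ₀ * (r φ : ℂ) = 0 := by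
        rw [← zero_div (c φ₀), ← Pi.zero_apply (M := fun _ : G => ℂ) h, ← this, Finset.sum_div]
        refine Finset.sum_congr rfl fun φ _ => ?_
        rw [Pi.smul_apply, smul_eq_mul, hσ φ, hr φ]
        ring
      exact (map_sum V.subtype _ _).trans h0
    have h2 := congrArg (IsLocalRing.residue V) h1
    rw [map_sum, map_zero] at h2
    rw [← h2]
    refine Finset.sum_congr rfl fun φ _ => ?_
    rw [map_mul, hgh, ← hrr, resMap_red]
    rfl
  have h1 : ∑ φ : s, IsLocalRing.residue V ⟨_, hd φ⟩ * ε (∑ g, x g * (σ φ).character g) = 0 := by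
    have : ∀ φ : s, IsLocalRing.residue V ⟨_, hd φ⟩ * ε (∑ g, x g * (σ φ).character g) =
        ∑ g, ε (x g) * (IsLocalRing.residue V ⟨_, hd φ⟩ * ε ((σ φ).character g)) := fun φ => by
      rw [map_sum, Finset.mul_sum]
      exact Finset.sum_congr rfl fun g _ => by rw [map_mul]; ring
    simp only [this]
    rw [Finset.sum_comm]
    simp only [← Finset.mul_sum, hrel, mul_zero, Finset.sum_const_zero]
  rw [Finset.sum_eq_single ⟨φ₀, hφ₀⟩ (fun φ _ hφ => by rw [hx₀ φ hφ, map_zero, mul_zero])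
    (by simp), hx₁, map_one, mul_one] at h1
  have h2 : (⟨c φ₀ / c φ₀, hd ⟨φ₀, hφ₀⟩⟩ : V) = 1 := Subtype.ext (div_self hc₀)
  rw [h2, map_one] at h1
  exact one_ne_zero h1

end independence

/-! ### Restriction to `p`-regular elements. -/

section hat

variable {G : Type*} [Group G]

/-- Restriction to the `p`-regular elements as a linear map. -/
def hatLinear (p : ℕ) : (G → ℂ) →ₗ[ℂ] (G → ℂ) where
  toFun := hat p
  map_add' f h := by
    funext g
    simp only [hat, Pi.add_apply]
    split_ifs <;> simp
  map_smul' c f := by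
    funext g
    simp only [hat, Pi.smul_apply, RingHom.id_apply]
    split_ifs <;> simp

theorem hatLinear_apply (p : ℕ) (f : G → ℂ) : hatLinear p f = hat p f := rfl

theorem hat_hat (p : ℕ) (f : G → ℂ) : hat p (hat p f) = hat p f := by
  funext g
  simp only [hat]
  split_ifs <;> rfl

theorem ip_hat_left [Fintype G] (p : ℕ) (f h : G → ℂ) : ip (hat p f) h = ip f (hat p h) := by
  simp only [ip, hat]
  congr 1
  refine Finset.sum_congr rfl fun g _ => ?_
  split_ifs <;> simp

end hat

section

variable {G : Type*} [Group G] (p : ℕ) {I : Ideal AlgInt} [I.IsMaximal]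

theorem isClassFunction_of_mem_IBr {φ : G → ℂ} (hφ : φ ∈ IBr G p I) : IsClassFunction φ := by
  obtain ⟨n, ρ, -, rfl⟩ := hφ
  intro g h
  have ho : orderOf (h * g * h⁻¹) = orderOf g := by
    rw [← MulAut.conj_apply, MulEquiv.orderOf_eq]
  let e : (Fin n → ResField I) ≃ₗ[ResField I] (Fin n → ResField I) :=
    LinearEquiv.ofLinearMap (ρ h) (ρ h⁻¹)
      (by rw [← End.mul_eq_comp, ← map_mul, mul_inv_cancel, map_one]; rfl)
      (by rw [← End.mul_eq_comp, ← map_mul, inv_mul_cancel, map_one]; rfl)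
  have hc : (ρ (h * g * h⁻¹)).charpoly = (ρ g).charpoly := by
    rw [← LinearEquiv.charpoly_conj e (ρ g), map_mul, map_mul]
    rfl
  rw [brauerCharacter, brauerCharacter, ho, hc]

theorem hat_eq_self_of_mem_IBr {φ : G → ℂ} (hφ : φ ∈ IBr G p I) : hat p φ = φ := by
  obtain ⟨n, ρ, -, rfl⟩ := hφ
  funext g
  simp only [hat, brauerCharacter]
  split_ifs <;> rfl

end

/-! ### PIMs: duality with `IBr(G)` and vanishing on `p`-singular elements. -/

section

variable {G : Type*} [Group G] [Fintype G] {p : ℕ} {I : Ideal AlgInt} [I.IsMaximal]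

theorem PIM_eq_sum (φ : IBr G p I) :
    PIM p I φ = ∑ χ : Irr G, decompositionNumber p I (χ : G → ℂ) φ • (χ : G → ℂ) :=
  finsum_eq_sum_of_fintype _

theorem ip_PIM (f : G → ℂ) (φ : IBr G p I) : ip f (PIM p I φ) =
    ∑ χ : Irr G, (decompositionNumber p I (χ : G → ℂ) φ : ℂ) * ip f χ := by
  rw [PIM_eq_sum, ip_sum_right]
  exact Finset.sum_congr rfl fun χ _ => ip_nsmul_right _ _ _

theorem ip_Irr_PIM {χ : G → ℂ} (hχ : χ ∈ Irr G) (φ : IBr G p I) :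
    ip χ (PIM p I φ) = decompositionNumber p I χ φ := by
  classical
  lift χ to Irr G using hχ
  rw [ip_PIM]
  simp [ip_Irr]

variable (G p I) in
/-- The irreducible Brauer constituents of the ordinary irreducible characters. -/
def brauerConstituents : Finset (IBr G p I) :=
  open Classical in
  Finset.univ.biUnion fun χ : Irr G => (decompositionNumber p I (χ : G → ℂ)).support

theorem mem_brauerConstituents {χ : G → ℂ} (hχ : χ ∈ Irr G) {φ : IBr G p I}
    (h : decompositionNumber p I χ φ ≠ 0) : φ ∈ brauerConstituents G p I := by
  classical
  exact Finset.mem_biUnion.2 ⟨⟨χ, hχ⟩, Finset.mem_univ _, Finsupp.mem_support_iff.2 h⟩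

variable [Fact p.Prime]

/-- Expand `f` in `Irr(G)`, then each `χ̂` in `IBr(G)`, and collect terms. `T` may be larger than
the set of known constituents, so that coefficients can be compared at any given `φ`. -/
theorem hat_eq_sum_ip_PIM (hpI : (p : AlgInt) ∈ I) {T : Finset (IBr G p I)}
    (hT : brauerConstituents G p I ⊆ T) {f : G → ℂ} (hf : IsClassFunction f) :
    hat p f = ∑ φ ∈ T, ip f (PIM p I φ) • (φ : G → ℂ) := by
  have hχ : ∀ χ : Irr G, hat p (χ : G → ℂ) =
      ∑ φ ∈ T, (decompositionNumber p I (χ : G → ℂ) φ : ℂ) • (φ : G → ℂ) := fun χ => by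
    rw [hat_eq_sum_decompositionNumber hpI χ.2, Finsupp.sum_of_support_subset _
      (fun φ hφ => hT (mem_brauerConstituents χ.2 (Finsupp.mem_support_iff.1 hφ))) _ (by simp)]
    exact Finset.sum_congr rfl fun φ _ => (Nat.cast_smul_eq_nsmul ℂ _ _).symm
  conv_lhs => rw [eq_sum_ip_Irr hf, ← hatLinear_apply, map_sum]
  simp only [map_smul, hatLinear_apply, hχ, Finset.smul_sum, smul_smul]
  rw [Finset.sum_comm]
  refine Finset.sum_congr rfl fun φ _ => ?_
  rw [ip_PIM, Finset.sum_smul]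
  exact Finset.sum_congr rfl fun χ _ => by rw [mul_comm]

theorem ip_IBr_PIM [DecidableEq (IBr G p I)] (hpI : (p : AlgInt) ∈ I) (ψ φ : IBr G p I) :
    ip (ψ : G → ℂ) (PIM p I φ) = if φ = ψ then 1 else 0 := by
  set T := insert ψ (insert φ (brauerConstituents G p I)) with hT
  have h := hat_eq_sum_ip_PIM hpI (T := T) (fun x hx => by simp [hT, hx])
    (isClassFunction_of_mem_IBr p ψ.2)
  rw [hat_eq_self_of_mem_IBr p ψ.2] at h
  have h0 : ∑ χ ∈ T, (ip (ψ : G → ℂ) (PIM p I χ) - if χ = ψ then 1 else 0) • (χ : G → ℂ) = 0 := by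
    simp only [sub_smul, Finset.sum_sub_distrib, ← h, ite_smul, one_smul, zero_smul]
    rw [Finset.sum_ite_eq', if_pos (by simp [hT]), sub_self]
  exact sub_eq_zero.1 (linearIndependent_iff'.1 (linearIndependent_IBr hpI) T _ h0 φ (by simp [hT]))

/-- The difference `f = Φ_φ - Φ̂_φ` has `f̂ = 0`, so comparing coefficients gives `⟨f, Φ_φ⟩ = 0`,
while `⟨f, Φ̂_φ⟩ = ⟨f̂, Φ_φ⟩ = 0`. Thus `⟨f, f⟩ = 0`. -/
theorem hat_PIM (hpI : (p : AlgInt) ∈ I) (φ : IBr G p I) : hat p (PIM p I φ) = PIM p I φ := by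
  classical
  have hcl : IsClassFunction (PIM p I φ) := fun g h => by
    simp only [PIM_eq_sum, Finset.sum_apply, Pi.smul_apply]
    exact Finset.sum_congr rfl fun χ _ => by rw [isClassFunction_of_mem_Irr χ.2]
  set f := PIM p I φ - hat p (PIM p I φ) with hf
  have hfcl : IsClassFunction f := fun g h => by
    simp only [hf, Pi.sub_apply, hcl g h, hcl.hat p g h]
  have hf0 : hat p f = 0 := by
    rw [hf, ← hatLinear_apply, map_sub, hatLinear_apply, hatLinear_apply, hat_hat, sub_self]
  have hT := hat_eq_sum_ip_PIM hpI (T := insert φ (brauerConstituents G p I))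
    (Finset.subset_insert _ _) hfcl
  rw [hf0] at hT
  have h1 : ip f (PIM p I φ) = 0 := linearIndependent_iff'.1 (linearIndependent_IBr hpI) _ _ hT.symm
    φ (Finset.mem_insert_self _ _)
  have h2 : ip f (hat p (PIM p I φ)) = 0 := by
    rw [← ip_hat_left, hf0, ← ipLeft_apply, map_zero]
  have h3 : f = 0 := eq_zero_of_ip_self_eq_zero (by
    conv_lhs => rw [hf, ip_sub_right, ← hf, h1, h2, sub_zero])
  exact (sub_eq_zero.1 h3).symm

theorem ip_hat_of_mem_GenProj (hpI : (p : AlgInt) ∈ I) (χ : G → ℂ) {X : G → ℂ}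
    (hX : X ∈ GenProj G p I) : ip (hat p χ) X = ip χ X := by
  have h : hat p X = X := by
    have : GenProj G p I ≤ LinearMap.eqLocus ((hatLinear p).restrictScalars ℤ) LinearMap.id := by
      rw [GenProj, Submodule.span_le]
      rintro _ ⟨φ, rfl⟩
      exact hat_PIM hpI φ
    exact this hX
  rw [ip_hat_left, h]

end

/-! ### Unions of blocks. -/

section

variable {G : Type*} [Group G] {p : ℕ} {I : Ideal AlgInt} [I.IsMaximal] {B : Set (Block G p I)}

theorem IrrB_subset_Irr : IrrB B ⊆ Irr G := fun _ h => h.1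

theorem GenProjB_le_GenProj : GenProjB B ≤ GenProj G p I :=
  Submodule.span_mono (Set.image_subset_range _ _)

theorem ProjB_subset_GenProjB {Φ : G → ℂ} (hΦ : Φ ∈ ProjB B) : Φ ∈ GenProjB B :=
  (AddSubmonoid.closure_le (S := (GenProjB B).toAddSubmonoid)).2 Submodule.subset_span hΦ

end

section blocks

variable {G : Type*} [Group G] [Fintype G] {p : ℕ} {I : Ideal AlgInt} [I.IsMaximal]
  {B : Set (Block G p I)}

instance finite_IrrB : Finite (IrrB B) := Finite.Set.subset (Irr G) IrrB_subset_Irr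

instance fintype_IrrB : Fintype (IrrB B) := Fintype.ofFinite _

instance finite_IBrB : Finite (IBrB B) :=
  Set.Finite.to_subtype (Set.Finite.subset (brauerConstituents G p I).finite_toSet
    fun _ ⟨_, hχ, hφ⟩ => mem_brauerConstituents (IrrB_subset_Irr hχ) hφ)

instance fintype_IBrB : Fintype (IBrB B) := Fintype.ofFinite _

theorem mem_IrrB_of_decompositionNumber_ne_zero {χ : G → ℂ} (hχ : χ ∈ Irr G) {φ : IBr G p I}
    (hφ : φ ∈ IBrB B) (h : decompositionNumber p I χ φ ≠ 0) : χ ∈ IrrB B := by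
  obtain ⟨ψ, ⟨hψ, hψB⟩, hd⟩ := hφ
  refine ⟨hχ, ?_⟩
  by_cases hne : χ = ψ
  · subst hne
    exact hψB
  have hadj : (brauerGraph G p I).Adj ⟨χ, hχ⟩ ⟨ψ, hψ⟩ := by
    rw [brauerGraph, SimpleGraph.fromRel_adj]
    exact ⟨fun h => hne (congrArg Subtype.val h), Or.inl ⟨φ, h, hd⟩⟩
  rwa [SimpleGraph.ConnectedComponent.connectedComponentMk_eq_of_adj hadj]

theorem PIM_mem_span_IrrB {φ : IBr G p I} (hφ : φ ∈ IBrB B) :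
    PIM p I φ ∈ Submodule.span ℤ (IrrB B) := by
  rw [PIM_eq_sum]
  refine Submodule.sum_mem _ fun χ _ => ?_
  by_cases h : decompositionNumber p I (χ : G → ℂ) φ = 0
  · rw [h, zero_smul]
    exact Submodule.zero_mem _
  · exact nsmul_mem (Submodule.subset_span
      (mem_IrrB_of_decompositionNumber_ne_zero χ.2 hφ h)) _

theorem GenProjB_le_span_IrrB : GenProjB B ≤ Submodule.span ℤ (IrrB B) := by
  rw [GenProjB, Submodule.span_le]
  rintro _ ⟨φ, hφ, rfl⟩
  exact PIM_mem_span_IrrB hφ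

theorem mem_span_IrrB {X : G → ℂ} (hX : X ∈ Submodule.span ℤ (IrrB B)) :
    ∃ z : IrrB B → ℤ, X = ∑ χ, z χ • (χ : G → ℂ) := by
  rw [← Subtype.range_coe (s := IrrB B)] at hX
  obtain ⟨z, hz⟩ := (Submodule.mem_span_range_iff_exists_fun ℤ).1 hX
  exact ⟨z, hz.symm⟩

theorem ip_IrrB_sum (z : IrrB B → ℤ) (χ : IrrB B) :
    ip (χ : G → ℂ) (∑ ψ, z ψ • (ψ : G → ℂ)) = z χ := by
  classical
  have h : ∀ ψ : IrrB B, ip (χ : G → ℂ) (ψ : G → ℂ) = if χ = ψ then 1 else 0 := fun ψ => by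
    split_ifs with h
    · rw [h, ip_Irr_self (IrrB_subset_Irr ψ.2)]
    · exact ip_Irr_of_ne (IrrB_subset_Irr χ.2) (IrrB_subset_Irr ψ.2) fun h' => h (Subtype.ext h')
  simp only [ip_sum_right, ip_zsmul_right, h]
  simp

/-- A generalized projective character supported on `Irr(B)` lies in `K₀(B)`. -/
theorem mem_GenProjB {X : G → ℂ} (hX : X ∈ GenProj G p I) (hXB : X ∈ Submodule.span ℤ (IrrB B)) :
    X ∈ GenProjB B := by
  -- Split `X` into its part `x` in `K₀(B)` and its part `y` from the other PIMs. The latter is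
  -- orthogonal to `Irr(B)` and, like `X` and `x`, supported on it, so it is zero.
  have hsup : GenProj G p I = GenProjB B ⊔ Submodule.span ℤ (PIM p I '' (IBrB B)ᶜ) := by
    rw [GenProj, GenProjB, ← Submodule.span_union, ← Set.image_union, Set.union_compl_self,
      Set.image_univ]
  rw [hsup] at hX
  obtain ⟨x, hx, y, hy, rfl⟩ := Submodule.mem_sup.1 hX
  have hyB : y ∈ Submodule.span ℤ (IrrB B) := by
    have := Submodule.sub_mem _ hXB (GenProjB_le_span_IrrB hx)
    rwa [add_sub_cancel_left] at this
  have hy0 : ∀ χ ∈ IrrB B, ∀ w ∈ Submodule.span ℤ (PIM p I '' (IBrB B)ᶜ), ip χ w = 0 := by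
    intro χ hχ w hw
    induction hw using Submodule.span_induction with
    | mem w hw =>
      obtain ⟨φ, hφ, rfl⟩ := hw
      rw [ip_Irr_PIM (IrrB_subset_Irr hχ)]
      by_contra h
      exact hφ ⟨χ, hχ, fun h' => h (by rw [h', Nat.cast_zero])⟩
    | zero => exact ip_zero_right χ
    | add v w _ _ hv hw =>
      rw [← ipRight_apply, map_add, ipRight_apply, ipRight_apply, hv, hw, add_zero]
    | smul n w _ hw => rw [ip_zsmul_right, hw, mul_zero]
  obtain ⟨z, rfl⟩ := mem_span_IrrB hyB
  have hz : ∀ χ, z χ = 0 := fun χ => by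
    have := hy0 χ χ.2 _ hy
    rw [ip_IrrB_sum] at this
    exact_mod_cast this
  simpa [hz] using hx

end blocks

/-! ### Projective atoms. -/

section dualBasis

variable {G : Type*} [Group G] [Fintype G] {p : ℕ} [Fact p.Prime] {I : Ideal AlgInt} [I.IsMaximal]
  {B : Set (Block G p I)}

theorem exists_isDualBasis (hpI : (p : AlgInt) ∈ I) {s : ℕ} {BS : Fin s → G → ℂ}
    (hBS : IsBasicSet B BS) : ∃ PA, IsDualBasis B BS PA := by
  classical
  have hrange : Subtype.val '' IBrB B = Set.range fun φ : IBrB B => (φ : G → ℂ) := by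
    rw [Set.image_eq_range]
  have hind : LinearIndependent ℂ fun φ : IBrB B => (φ : G → ℂ) :=
    (linearIndependent_IBr hpI).comp _ Subtype.val_injective
  have hspan := hBS.span_eq
  rw [GenBrauerB, hrange] at hspan
  have h1 : ∀ φ : IBrB B, ∃ e : Fin s → ℤ, ∑ i, e i • BS i = (φ : G → ℂ) := fun φ =>
    (Submodule.mem_span_range_iff_exists_fun ℤ).1 (hspan ▸ Submodule.subset_span ⟨φ, rfl⟩)
  have h2 : ∀ i, ∃ c : IBrB B → ℤ, ∑ φ, c φ • (φ : G → ℂ) = BS i := fun i =>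
    (Submodule.mem_span_range_iff_exists_fun ℤ).1 (hspan ▸ Submodule.subset_span ⟨i, rfl⟩)
  choose e he using h1
  choose c hc using h2
  have hec : ∀ φ ψ, ∑ i, e φ i * c i ψ = if ψ = φ then 1 else 0 := by
    intro φ ψ
    have h0 : ∑ ψ, (∑ i, e φ i * c i ψ - if ψ = φ then 1 else 0) • (ψ : G → ℂ) = 0 := by
      simp only [sub_smul, Finset.sum_sub_distrib, ite_smul, one_smul, zero_smul,
        Finset.sum_ite_eq', Finset.mem_univ, if_true, Finset.sum_smul, mul_smul]
      rw [Finset.sum_comm]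
      simp only [← Finset.smul_sum, hc, he, sub_self]
    exact sub_eq_zero.1 (Fintype.linearIndependent_iff.1 (hind.restrict_scalars' ℤ) _ h0 ψ)
  have hce : ∀ i j, ∑ φ, c i φ * e φ j = if j = i then 1 else 0 := by
    intro i j
    have h0 : ∑ j, (∑ φ, c i φ * e φ j - if j = i then 1 else 0) • BS j = 0 := by
      simp only [sub_smul, Finset.sum_sub_distrib, ite_smul, one_smul, zero_smul,
        Finset.sum_ite_eq', Finset.mem_univ, if_true, Finset.sum_smul, mul_smul]
      rw [Finset.sum_comm]
      simp only [← Finset.smul_sum, hc, he, sub_self]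
    exact sub_eq_zero.1 (Fintype.linearIndependent_iff.1 hBS.linearIndependent _ h0 j)
  -- `c` and `e` are the mutually inverse base changes between `BS` and `IBr(B)`. Since the PIMs are
  -- dual to `IBr(B)`, the basis dual to `BS` comes from the transpose of `e`.
  let PA : Fin s → G → ℂ := fun j => ∑ φ : IBrB B, e φ j • PIM p I φ
  have hdual : ∀ i j, ip (BS i) (PA j) = if i = j then 1 else 0 := by
    intro i j
    have h : ∀ φ ψ : IBrB B, ip (φ : G → ℂ) (PIM p I ψ) = if ψ = φ then 1 else 0 := fun φ ψ => by
      rw [ip_IBr_PIM hpI]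
      simp only [Subtype.ext_iff]
    rw [← hc i]
    simp only [PA, ip_sum_left, ip_sum_right, ip_zsmul_left, ip_zsmul_right, h]
    have := congrArg (Int.cast : ℤ → ℂ) (hce i j)
    push_cast at this
    simpa [eq_comm, mul_comm] using this
  refine ⟨PA, ?_, le_antisymm ?_ ?_, hdual⟩
  · rw [Fintype.linearIndependent_iff]
    intro n hn i
    have := congrArg (ip (BS i)) hn
    simp only [ip_sum_right, ip_zsmul_right, hdual, ip_zero_right] at this
    simpa using this
  · rw [Submodule.span_le]
    rintro _ ⟨j, rfl⟩
    exact Submodule.sum_mem _ fun φ _ => Submodule.smul_mem _ _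
      (Submodule.subset_span ⟨φ, φ.2, rfl⟩)
  · rw [GenProjB, Submodule.span_le]
    rintro _ ⟨ψ, hψ, rfl⟩
    have : PIM p I ψ = ∑ j, c j ⟨ψ, hψ⟩ • PA j := by
      simp only [PA, Finset.smul_sum, smul_smul]
      rw [Finset.sum_comm]
      simp only [← Finset.sum_smul, mul_comm (c _ _), hec, ite_smul, one_smul, zero_smul]
      simp
    rw [this]
    exact Submodule.sum_mem _ fun j _ => Submodule.smul_mem _ _ (Submodule.subset_span ⟨j, rfl⟩)

theorem isDualBasis_atoms (hpI : (p : AlgInt) ∈ I) {s : ℕ} {BS : Fin s → G → ℂ}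
    (hBS : IsBasicSet B BS) : IsDualBasis B BS (atoms B BS) :=
  Classical.epsilon_spec (exists_isDualBasis hpI hBS)

theorem mem_GenProjB_iff_exists_atoms (hpI : (p : AlgInt) ∈ I) {s : ℕ} {BS : Fin s → G → ℂ}
    (hBS : IsBasicSet B BS) {X : G → ℂ} :
    X ∈ GenProjB B ↔ ∃ n : Fin s → ℤ, X = ∑ i, n i • atoms B BS i := by
  rw [← (isDualBasis_atoms hpI hBS).span_eq, Submodule.mem_span_range_iff_exists_fun]
  simp only [eq_comm]

theorem ip_sum_atoms (hpI : (p : AlgInt) ∈ I) {s : ℕ} {BS : Fin s → G → ℂ}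
    (hBS : IsBasicSet B BS) (n : Fin s → ℤ) (i : Fin s) :
    ip (BS i) (∑ j, n j • atoms B BS j) = n i := by
  simp only [ip_sum_right, ip_zsmul_right, (isDualBasis_atoms hpI hBS).dual]
  simp

end dualBasis

/-! ### Subsums and the main theorem. -/

section

variable {G : Type*} [Group G] [Fintype G] {p : ℕ} {I : Ideal AlgInt} [I.IsMaximal]
  {B : Set (Block G p I)}

/-- Subsums in terms of integral coordinates. -/
theorem isSubsum_iff {Φ Φ' : G → ℂ} : IsSubsum B Φ Φ' ↔
    (∃ z z' : IrrB B → ℤ, (∀ χ, 0 ≤ z' χ ∧ z' χ ≤ z χ) ∧ Φ = ∑ χ, z χ • (χ : G → ℂ) ∧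
      Φ' = ∑ χ, z' χ • (χ : G → ℂ)) ∧ Φ' ≠ 0 ∧ Φ' ≠ Φ := by
  refine and_congr_left fun _ => ⟨?_, ?_⟩
  · rintro ⟨a, a', haa, rfl, rfl⟩
    refine ⟨fun χ => a χ, fun χ => a' χ,
      fun χ => ⟨Int.natCast_nonneg _, Int.ofNat_le.2 (haa χ)⟩, ?_, ?_⟩
    · rw [Finsupp.sum_fintype _ _ (by simp)]
      simp
    · rw [Finsupp.sum_fintype _ _ (by simp)]
      simp
  · rintro ⟨z, z', hz, rfl, rfl⟩
    refine ⟨Finsupp.equivFunOnFinite.symm fun χ => (z χ).toNat,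
      Finsupp.equivFunOnFinite.symm fun χ => (z' χ).toNat,
      fun χ => Int.toNat_le_toNat (hz χ).2, ?_, ?_⟩
    · rw [Finsupp.sum_fintype _ _ (by simp)]
      refine Finset.sum_congr rfl fun χ _ => ?_
      rw [← natCast_zsmul]
      simp [Int.toNat_of_nonneg ((hz χ).1.trans (hz χ).2)]
    · rw [Finsupp.sum_fintype _ _ (by simp)]
      refine Finset.sum_congr rfl fun χ _ => ?_
      rw [← natCast_zsmul]
      simp [Int.toNat_of_nonneg (hz χ).1]

end

end ModRep

end

theorem mainTheorem8 {G : Type*} [Group G] [Fintype G] (p : ℕ) [Fact p.Prime]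
    (I : Ideal ModRep.AlgInt) [I.IsMaximal] (hpI : (p : ModRep.AlgInt) ∈ I)
    (B : Set (ModRep.Block G p I))
    {s : ℕ} (BS : Fin s → G → ℂ) (hBS : ModRep.IsSpecialBasicSet B BS)
    (BB : Set (G → ℂ)) (hBB : BB = ModRep.hatIrrB B)
    (Φ : G → ℂ) (hΦ : Φ ∈ ModRep.ProjB B) :
    ModRep.PIMTestProves B BS BB Φ ↔
      ¬ ∃ Φ' : G → ℂ, ModRep.IsSubsum B Φ Φ' ∧ Φ' ∈ ModRep.GenProj G p I := by
  open ModRep in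
  subst hBB
  have hΦB := ProjB_subset_GenProjB hΦ
  have hbas := hBS.toIsBasicSet
  constructor
  · rintro htest ⟨Φ', hsub, hΦ'⟩
    obtain ⟨⟨z, z', hz, hΦz, hΦz'⟩, h0, hne⟩ := isSubsum_iff.1 hsub
    -- A subsum is only assumed to lie in `K₀` of the whole group; membership in `K₀(B)` is what
    -- gives its expansion into atoms.
    have hΦB' : Φ' ∈ GenProjB B := mem_GenProjB hΦ' (hΦz' ▸ Submodule.sum_mem _ fun χ _ =>
      Submodule.smul_mem _ _ (Submodule.subset_span χ.2))
    obtain ⟨n, hn⟩ := (mem_GenProjB_iff_exists_atoms hpI hbas).1 hΦB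
    obtain ⟨n', hn'⟩ := (mem_GenProjB_iff_exists_atoms hpI hbas).1 hΦB'
    have hip : ∀ χ : IrrB B, ip (hat p (χ : G → ℂ)) Φ = z χ := fun χ => by
      rw [ip_hat_of_mem_GenProj hpI _ (GenProjB_le_GenProj hΦB), hΦz, ip_IrrB_sum]
    have hip' : ∀ χ : IrrB B, ip (hat p (χ : G → ℂ)) Φ' = z' χ := fun χ => by
      rw [ip_hat_of_mem_GenProj hpI _ hΦ', hΦz', ip_IrrB_sum]
    have hpart : IsPart B BS Φ Φ' := by
      refine ⟨hΦ', n, n', hn, hn', fun i => ?_⟩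
      -- As `φ_i = χ̂`, the coordinates `n i` and `n' i` are the multiplicities `z χ` and `z' χ`.
      obtain ⟨χ, hχ, hi⟩ := hBS.special i
      have h1 := ip_sum_atoms hpI hbas n i
      have h2 := ip_sum_atoms hpI hbas n' i
      rw [← hn, hi, hip ⟨χ, hχ⟩] at h1
      rw [← hn', hi, hip' ⟨χ, hχ⟩] at h2
      rw [← Int.cast_injective (α := ℂ) h1, ← Int.cast_injective (α := ℂ) h2]
      exact hz _
    obtain ⟨_, ⟨χ, hχ, rfl⟩, hneg⟩ := htest Φ' hpart hne h0
    rw [ip_sub_right, hip ⟨χ, hχ⟩, hip' ⟨χ, hχ⟩] at hneg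
    have := hz ⟨χ, hχ⟩
    rw [← Int.cast_sub, Complex.intCast_re, Complex.intCast_re, Int.cast_lt_zero,
      Int.cast_lt_zero] at hneg
    omega
  · intro hno Φ' hpart hne h0
    by_contra! hnn
    obtain ⟨hΦ', n, n', hn, hn', -⟩ := hpart
    have hΦB' : Φ' ∈ GenProjB B := (mem_GenProjB_iff_exists_atoms hpI hbas).2 ⟨n', hn'⟩
    obtain ⟨z, hΦz⟩ := mem_span_IrrB (GenProjB_le_span_IrrB hΦB)
    obtain ⟨z', hΦz'⟩ := mem_span_IrrB (GenProjB_le_span_IrrB hΦB')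
    refine hno ⟨Φ', isSubsum_iff.2 ⟨⟨z, z', fun χ => ?_, hΦz, hΦz'⟩, h0, hne⟩, hΦ'⟩
    -- The two inequalities of the test at `χ̂` read `0 ≤ z' χ` and `0 ≤ z χ - z' χ`.
    have h := hnn (hat p χ) ⟨χ, χ.2, rfl⟩
    rw [ip_sub_right, ip_hat_of_mem_GenProj hpI _ (GenProjB_le_GenProj hΦB),
      ip_hat_of_mem_GenProj hpI _ hΦ'] at h
    rw [hΦz, hΦz', ip_IrrB_sum, ip_IrrB_sum, ← Int.cast_sub, Complex.intCast_re,
      Complex.intCast_re, Int.cast_nonneg_iff, Int.cast_nonneg_iff] at h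
    omega
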